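/- Let $g:(0,\infty)\to\mathbb{C}$. Define the Widder transform and the $\mathscr{K}_\nu$-transform by $$\mathscr{P}\{f(u);x\}=\int_0^\infty \frac{u\,f(u)}{u^2+x^2}\,du,\qquad \mathscr{K}_\nu\{f(u);y\}=\int_0^\infty \sqrt{uy}\,K_\nu(uy)\,f(u)\,du\qquad(x,y>0),$$ where $K_\nu(x)=\int_0^\infty e^{-x\cosh t}\cosh(\nu t)\,dt$ is the modified Bessel (Macdonald) function of complex order $\nu$. Let $\mu,\nu\in\mathbb{C}$ satisfy $-\operatorname{Re}\nu-\tfrac32<\operatorname{Re}\mu<-\tfrac12$. Then each of the following identities holds provided that both of its members exist: $$\int_0^\infty x^{\mu+\nu+\frac12}\,\mathscr{P}\{u^{-\nu-\frac12}g(u);x\}\,dx = 2^{\mu+\frac12}\,\frac{\Gamma\left(\frac{\mu}{2}+\frac{\nu}{2}+\frac34\right)}{\Gamma\left(\frac{\nu}{2}-\frac{\mu}{2}+\frac14\right)}\int_0^\infty y^{-\mu-1}\,\mathscr{K}_\nu\{g(u);y\}\,dy,\tag{1}$$ $$\int_0^\infty y^{-\mu-1}\,\mathscr{K}_\nu\{g(u);y\}\,dy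 = 2^{-\mu-\frac32}\,\Gamma\left(\tfrac{\nu}{2}-\tfrac{\mu}{2}+\tfrac14\right)\Gamma\left(\tfrac14-\tfrac{\mu}{2}-\tfrac{\nu}{2}\right)\int_0^\infty u^{\mu}g(u)\,du,\tag{2}$$ $$\int_0^\infty x^{\mu+\nu+\frac12}\,\mathscr{P}\{u^{-\nu-\frac12}g(u);x\}\,dx = \tfrac12\,\Gamma\left(\tfrac{\mu}{2}+\tfrac{\nu}{2}+\tfrac34\right)\Gamma\left(\tfrac14-\tfrac{\mu}{2}-\tfrac{\nu}{2}\right)\int_0^\infty u^{\mu}g(u)\,du.\tag{3}$$ Here a member exists if the integrals in it converge absolutely (for an iterated integral: the inner integral for almost every value of the outer variable, and then the outer integral) and the Gamma factors in it are defined; the latter means that in (2) and (3) the number $\frac14-\frac{\mu}{2}-\frac{\nu}{2}$ is not one of $0,-1,-2,\dots$ (the other Gamma arguments have positive real part). -/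

import Mathlib

open MeasureTheory Set

noncomputable section

/-- The modified Bessel function of the second kind (Macdonald function) `K_ν(x)` of complex
order `ν` at a real argument `x > 0`:
`K_ν(x) = ∫₀^∞ exp (-x cosh t) cosh (ν t) dt`. -/
def macdonaldK (ν : ℂ) (x : ℝ) : ℂ :=
  ∫ t in Ioi (0 : ℝ), (Real.exp (-x * Real.cosh t) : ℂ) * Complex.cosh (ν * (t : ℂ))

/-- The integrand `u f(u) / (u² + x²)` of the Widder transform of `f` at `x`. -/
def widderIntegrand (f : ℝ → ℂ) (x u : ℝ) : ℂ :=
  (u : ℂ) * f u / ((u : ℂ) ^ 2 + (x : ℂ) ^ 2)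

/-- The Widder transform `P{f(u); x} = ∫₀^∞ u f(u) / (u² + x²) du`. -/
def widderTransform (f : ℝ → ℂ) (x : ℝ) : ℂ :=
  ∫ u in Ioi (0 : ℝ), widderIntegrand f x u

/-- The integrand `√(u y) K_ν(u y) f(u)` of the `K_ν`-transform of `f` at `y`. -/
def kIntegrand (ν : ℂ) (f : ℝ → ℂ) (y u : ℝ) : ℂ :=
  (Real.sqrt (u * y) : ℂ) * macdonaldK ν (u * y) * f u

/-- The `K_ν`-transform `K_ν{f(u); y} = ∫₀^∞ √(u y) K_ν(u y) f(u) du`. -/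
def kTransform (ν : ℂ) (f : ℝ → ℂ) (y : ℝ) : ℂ :=
  ∫ u in Ioi (0 : ℝ), kIntegrand ν f y u

/-- The iterated integral `∫₀^∞ x^a P{f(u); x} dx` exists: the Widder transform converges
absolutely at almost every `x > 0`, and so does the outer integral. -/
def WidderMomentExists (a : ℂ) (f : ℝ → ℂ) : Prop :=
  (∀ᵐ x ∂(volume.restrict (Ioi (0 : ℝ))), IntegrableOn (widderIntegrand f x) (Ioi 0)) ∧
    IntegrableOn (fun x : ℝ => (x : ℂ) ^ a * widderTransform f x) (Ioi 0)

/-- The iterated integral `∫₀^∞ y^a K_ν{f(u); y} dy` exists: the `K_ν`-transform converges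
absolutely at almost every `y > 0`, and so does the outer integral. -/
def KMomentExists (ν a : ℂ) (f : ℝ → ℂ) : Prop :=
  (∀ᵐ y ∂(volume.restrict (Ioi (0 : ℝ))), IntegrableOn (kIntegrand ν f y) (Ioi 0)) ∧
    IntegrableOn (fun y : ℝ => (y : ℂ) ^ a * kTransform ν f y) (Ioi 0)

end

/-!
Put `h(u) = u^{1/2-ν} g(u)` and `b = μ/2 + ν/2 + 3/4`, so that `Re b > 0`, `Re (ν + 1 - b) > 0` and
`Re ν > -1`. After the substitutions `w = x⁻²` and `w = y²` both transforms have the form `T(w) = ∫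
k(w u²) h(u) du`, the moments become multiples of `∫ w^{-b} T(w) dw`, and `u^μ g(u)` is `u^{2b-2}
h(u)`. The kernels are `1 / (1 + z) = ∫ e^{-τ} e^{-zτ} dτ` and `∫ τ^{ν-1} e^{-τ} e^{-z/(4τ)} dτ`,
the latter being `2^{1-ν} x^ν K_ν(x)` at `z = x²` (`heatMacdonald_sq`). Both are superpositions of
exponentials, so formally each moment is an explicit Gamma factor times `Γ(1-b) ∫ u^{2b-2} h(u)
du`. The hypotheses are too weak for Fubini's theorem, and for `Re b ≥ 1` the integral `∫ w^{-b}
e^{-w} dw` diverges. The remedy is to compare averages `∫ χ(v) T(vw) dv` over dilations: their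
moments are those of `T` times `∫ χ(v) v^{b-1} dv` (`integral_cpow_mul_integral_dilate`), and `χ`
can be chosen to make the inner integrals absolutely convergent.

* The two identities with `∫ u^μ g(u) du` on the right follow with the Laguerre function `χ(v) =
  L_n(v) e^{-v}`, `n > Re b`, which replaces `e^{-z}` by `zⁿ / (1 + z)ⁿ⁺¹`. The latter has an
  absolutely convergent moment, and the factor `∫ χ(v) v^{b-1} dv = Γ(b) (1-b)_n / n!` does not
  vanish as `1 - b` is not a pole of `Γ`. See `integral_cpow_neg_mul_expSuperposition`.
* In the identity between the two moments, `∫ u^{2b-2} h(u) du` need not exist. Averaging the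
  Macdonald transform against `(ν + 1 - v) e^{-v}` gives the same function as averaging the Widder
  transform, dilated by `1/(4τ)`, against `τ^ν e^{-τ}`
  (`integral_laguerreWeight_mul_quadTransform`); taking moments of both sides gives the identity.
  Absolute convergence (`integrable_laguerreWeight_mul_heatMacdonald`) rests on
  `exists_norm_heatMacdonald_dilate_le`, which bounds the Macdonald kernel at one scale by its
  values at another, since convergence of the transform is known only at almost every `y`.
-/

section

open scoped Nat

/-! ### Gamma integrals and moments of averaged dilates -/

theorem measurable_ofReal_cpow (c : ℂ) : Measurable fun x : ℝ => (x : ℂ) ^ c :=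
  Complex.measurable_ofReal.pow_const c

theorem integrableOn_cpow_mul_exp_neg_mul {a : ℂ} (ha : 0 < a.re) {r : ℝ} (hr : 0 < r) :
    IntegrableOn (fun t : ℝ => (t : ℂ) ^ (a - 1) * (Real.exp (-(r * t)) : ℂ)) (Ioi 0) := by
  have h := Complex.GammaIntegral_convergent ha
  have h2 := (integrableOn_Ioi_comp_mul_left_iff
    (fun x : ℝ => ((Real.exp (-x) : ℝ) : ℂ) * (x : ℂ) ^ (a - 1)) 0 hr).mpr (by simpa using h)
  have h3 := h2.const_mul ((r : ℂ) ^ (1 - a))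
  refine IntegrableOn.congr_fun h3 (fun t ht => ?_) measurableSet_Ioi
  have ht' : (0 : ℝ) < t := ht
  have hr' : (r : ℂ) ≠ 0 := by exact_mod_cast hr.ne'
  simp only [Complex.ofReal_mul]
  rw [Complex.mul_cpow_ofReal_nonneg hr.le ht'.le]
  have : (r : ℂ) ^ (1 - a) * (r : ℂ) ^ (a - 1) = 1 := by
    rw [← Complex.cpow_add _ _ hr']; simp
  linear_combination (t : ℂ) ^ (a - 1) * (Real.exp (-(r * t)) : ℂ) * this

theorem integral_cpow_mul_exp_neg_mul {a : ℂ} (ha : 0 < a.re) {r : ℝ} (hr : 0 < r) :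
    ∫ t in Ioi (0 : ℝ), (t : ℂ) ^ (a - 1) * (Real.exp (-(r * t)) : ℂ) =
      (1 / (r : ℂ)) ^ a * Complex.Gamma a := by
  rw [← Complex.integral_cpow_mul_exp_neg_mul_Ioi ha hr]
  simp

theorem integrableOn_pow_mul_exp_neg_mul (n : ℕ) {r : ℝ} (hr : 0 < r) :
    IntegrableOn (fun t : ℝ => (t : ℂ) ^ n * (Real.exp (-(r * t)) : ℂ)) (Ioi 0) := by
  have := integrableOn_cpow_mul_exp_neg_mul (a := n + 1) (by simp; positivity) hr
  simpa using this

theorem integral_pow_mul_exp_neg_mul (n : ℕ) {r : ℝ} (hr : 0 < r) :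
    ∫ t in Ioi (0 : ℝ), (t : ℂ) ^ n * (Real.exp (-(r * t)) : ℂ) = n ! / (r : ℂ) ^ (n + 1) := by
  have := integral_cpow_mul_exp_neg_mul (a := n + 1) (by simp; positivity) hr
  rw [Complex.Gamma_nat_eq_factorial] at this
  simp only [add_sub_cancel_right, Complex.cpow_natCast] at this
  rw [this]
  have : ((n : ℂ) + 1) = ((n + 1 : ℕ) : ℂ) := by push_cast; ring
  rw [this, Complex.cpow_natCast, one_div, inv_pow, div_eq_inv_mul]

/-- The moment `∫ w ^ (-b) T(w) dw` turns a superposition of dilates of `T` into a product: this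
is the Mellin transform of a multiplicative convolution, with the dilations `s y` and the weights
`χ y` carried by an arbitrary measure space. -/
theorem integral_cpow_mul_integral_dilate {Y : Type*} [MeasurableSpace Y] (m : Measure Y)
    [SFinite m] {χ : Y → ℂ} {s : Y → ℝ} (hχ : AEStronglyMeasurable χ m) (hs : Measurable s)
    (hpos : ∀ᵐ y ∂m, 0 < s y) {T : ℝ → ℂ} (hT : StronglyMeasurable T) (b : ℂ)
    (hχb : Integrable (fun y => χ y * (s y : ℂ) ^ (b - 1)) m)
    (hI : IntegrableOn (fun w : ℝ => (w : ℂ) ^ (-b) * T w) (Ioi 0)) :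
    IntegrableOn (fun w : ℝ => (w : ℂ) ^ (-b) * ∫ y, χ y * T (s y * w) ∂m) (Ioi 0) ∧
    ∫ w in Ioi (0 : ℝ), (w : ℂ) ^ (-b) * ∫ y, χ y * T (s y * w) ∂m =
      (∫ y, χ y * (s y : ℂ) ^ (b - 1) ∂m) * ∫ w in Ioi (0 : ℝ), (w : ℂ) ^ (-b) * T w := by
  set F : Y × ℝ → ℂ := fun p => χ p.1 * ((p.2 : ℂ) ^ (-b) * T (s p.1 * p.2)) with hF
  -- dilating the variable `w` by `s y`
  have key : ∀ y, 0 < s y → ∀ w ∈ Ioi (0 : ℝ), (w : ℂ) ^ (-b) * T (s y * w) =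
      (s y : ℂ) ^ b * ((fun w : ℝ => (w : ℂ) ^ (-b) * T w) (s y * w)) := by
    intro y hy w hw
    have hw' : (0 : ℝ) < w := hw
    have hy' : (s y : ℂ) ≠ 0 := by exact_mod_cast hy.ne'
    simp only [Complex.ofReal_mul]
    rw [Complex.mul_cpow_ofReal_nonneg hy.le hw'.le]
    have : (s y : ℂ) ^ b * (s y : ℂ) ^ (-b) = 1 := by
      rw [← Complex.cpow_add _ _ hy']; simp
    linear_combination (-(w : ℂ) ^ (-b) * T (s y * w)) * this
  have hmeas : AEStronglyMeasurable F (m.prod (volume.restrict (Ioi 0))) := by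
    refine hχ.comp_fst.mul (StronglyMeasurable.aestronglyMeasurable ?_)
    refine StronglyMeasurable.mul ?_ ?_
    · exact ((measurable_ofReal_cpow (-b)).comp measurable_snd).stronglyMeasurable
    · exact hT.comp_measurable ((hs.comp measurable_fst).mul measurable_snd)
  have hint : Integrable F (m.prod (volume.restrict (Ioi 0))) := by
    rw [integrable_prod_iff hmeas]
    constructor
    · filter_upwards [hpos] with y hy
      refine Integrable.const_mul (f := fun w : ℝ => (w : ℂ) ^ (-b) * T (s y * w)) ?_ (χ y)
      have := (integrableOn_Ioi_comp_mul_left_iff (fun w : ℝ => (w : ℂ) ^ (-b) * T w) 0 hy).mpr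
        (by simpa using hI)
      exact IntegrableOn.congr_fun (this.const_mul ((s y : ℂ) ^ b))
        (fun w hw => (key y hy w hw).symm) measurableSet_Ioi
    · have := hχb.norm.mul_const (∫ w in Ioi (0 : ℝ), ‖(w : ℂ) ^ (-b) * T w‖)
      refine this.congr ?_
      filter_upwards [hpos] with y hy
      have e : ∀ w ∈ Ioi (0 : ℝ), ‖F (y, w)‖ = ‖χ y‖ * ‖(s y : ℂ) ^ b‖ *
          (fun w : ℝ => ‖(w : ℂ) ^ (-b) * T w‖) (s y * w) := by
        intro w hw
        simp only [hF]
        rw [key y hy w hw, norm_mul, norm_mul, mul_assoc]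
      rw [setIntegral_congr_fun measurableSet_Ioi e, integral_const_mul,
        integral_comp_mul_left_Ioi (fun w : ℝ => ‖(w : ℂ) ^ (-b) * T w‖) _ hy, mul_zero,
        smul_eq_mul, norm_mul (χ y),
        Complex.norm_cpow_eq_rpow_re_of_pos hy, Complex.norm_cpow_eq_rpow_re_of_pos hy,
        Complex.sub_re, Complex.one_re, Real.rpow_sub_one hy.ne']
      ring
  have hout : ∀ w : ℝ, (w : ℂ) ^ (-b) * ∫ y, χ y * T (s y * w) ∂m = ∫ y, F (y, w) ∂m := by
    intro w
    rw [← integral_const_mul]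
    refine integral_congr_ae (Filter.Eventually.of_forall fun y => ?_)
    simp only [hF]; ring
  simp only [hout]
  refine ⟨hint.integral_prod_right, ?_⟩
  rw [integral_integral_swap (f := fun w y => F (y, w)) hint.swap, ← integral_mul_const]
  refine integral_congr_ae ?_
  filter_upwards [hpos] with y hy
  have e : ∀ w ∈ Ioi (0 : ℝ), F (y, w) = χ y * (s y : ℂ) ^ b *
      (fun w : ℝ => (w : ℂ) ^ (-b) * T w) (s y * w) := by
    intro w hw
    simp only [hF]
    rw [key y hy w hw, mul_assoc]
  have hy' : (s y : ℂ) ≠ 0 := by exact_mod_cast hy.ne'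
  rw [setIntegral_congr_fun measurableSet_Ioi e, integral_const_mul,
    integral_comp_mul_left_Ioi (fun w : ℝ => (w : ℂ) ^ (-b) * T w) _ hy, mul_zero,
    Complex.cpow_sub _ _ hy', Complex.cpow_one,
    Complex.real_smul, Complex.ofReal_inv]
  field_simp

/-! ### A finite sum of Gamma values -/

theorem Gamma_add_natCast {b : ℂ} (hb : ∀ n : ℕ, b ≠ -(n : ℂ)) (j : ℕ) :
    Complex.Gamma (b + j) = (ascPochhammer ℂ j).eval b * Complex.Gamma b := by
  induction j with
  | zero => simp
  | succ j ih =>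
    have h : b + j ≠ 0 := fun h => hb j (eq_neg_of_add_eq_zero_left h)
    rw [Nat.cast_succ, ← add_assoc, Complex.Gamma_add_one _ h, ih, ascPochhammer_succ_eval]
    ring

theorem ascPochhammer_eval_eq_multichoose (b : ℂ) (j : ℕ) :
    (ascPochhammer ℂ j).eval b = j ! * Ring.multichoose b j := by
  rw [← nsmul_eq_mul, Ring.factorial_nsmul_multichoose_eq_ascPochhammer,
    Polynomial.ascPochhammer_smeval_eq_eval]

/-- The Mellin transform of the Laguerre function `L_n(v) e^{-v}`, in finite form; it is an
instance of the Chu–Vandermonde identity. -/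
theorem sum_choose_mul_Gamma {b : ℂ} (hb : ∀ n : ℕ, b ≠ -(n : ℂ)) (n : ℕ) :
    ∑ j ∈ Finset.range (n + 1), (n.choose j : ℂ) * (-1) ^ j / j ! * Complex.Gamma (b + j) =
      Complex.Gamma b * (ascPochhammer ℂ n).eval (1 - b) / n ! := by
  have hn (j : ℕ) : (j ! : ℂ) ≠ 0 := by exact_mod_cast j.factorial_ne_zero
  have h := Ring.add_choose_eq n (Commute.all (-b) (n : ℂ))
  rw [Finset.Nat.sum_antidiagonal_eq_sum_range_succ
    (fun i j => Ring.choose (-b) i * Ring.choose (n : ℂ) j)] at h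
  have e : Ring.choose (-b + (n : ℂ)) n = Ring.multichoose (1 - b) n := by
    rw [Ring.multichoose_eq]; congr 1; ring
  rw [ascPochhammer_eval_eq_multichoose, ← e, h, mul_div_assoc, mul_div_cancel_left₀ _ (hn n),
    Finset.mul_sum]
  refine Finset.sum_congr rfl fun j hj => ?_
  have hj' : j ≤ n := Nat.lt_succ_iff.mp (Finset.mem_range.mp hj)
  rw [Ring.choose_natCast, Nat.choose_symm hj', Ring.choose_neg, ← Ring.multichoose_eq,
    Gamma_add_natCast hb, ascPochhammer_eval_eq_multichoose]
  have : Int.negOnePow (j : ℤ) • Ring.multichoose b j = (-1) ^ j * Ring.multichoose b j := by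
    rw [Int.negOnePow_def, Units.smul_def]
    simp
  rw [this]
  field_simp [hn j]

/-! ### Moments of superpositions of exponentials -/

/-- Superpositions of exponentials `w ↦ ∫ f(x) e^{-w ρ(x)} dx`: the Laplace transform of the
complex measure `f` transported by the rate `ρ`. -/
noncomputable def expSuperposition {X : Type*} [MeasurableSpace X] (m : Measure X) (ρ : X → ℝ)
    (f : X → ℂ) (w : ℝ) : ℂ :=
  ∫ x, f x * (Real.exp (-(w * ρ x)) : ℂ) ∂m

theorem stronglyMeasurable_expSuperposition {X : Type*} [MeasurableSpace X] {m : Measure X}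
    [SFinite m] {ρ : X → ℝ} {f : X → ℂ} (hf : AEStronglyMeasurable f m) (hρ : Measurable ρ) :
    StronglyMeasurable (expSuperposition m ρ f) := by
  have h : expSuperposition m ρ f = expSuperposition m ρ (hf.mk f) := by
    funext w
    refine integral_congr_ae ?_
    filter_upwards [hf.ae_eq_mk] with x hx
    rw [hx]
  rw [h]
  refine StronglyMeasurable.integral_prod_right
    (f := fun (w : ℝ) x => hf.mk f x * (Real.exp (-(w * ρ x)) : ℂ)) ?_
  refine (hf.stronglyMeasurable_mk.comp_measurable measurable_snd).mul
    (Measurable.stronglyMeasurable ?_)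
  exact Complex.measurable_ofReal.comp (Real.measurable_exp.comp
    (measurable_fst.mul (hρ.comp measurable_snd)).neg)

theorem integral_norm_pow_mul_exp_neg_mul (n : ℕ) {r : ℝ} (hr : 0 < r) :
    ∫ t in Ioi (0 : ℝ), ‖(t : ℂ) ^ n * (Real.exp (-(r * t)) : ℂ)‖ = n ! / r ^ (n + 1) := by
  have h := integral_pow_mul_exp_neg_mul n hr
  have e : ∀ t ∈ Ioi (0 : ℝ), (t : ℂ) ^ n * (Real.exp (-(r * t)) : ℂ) =
      ((‖(t : ℂ) ^ n * (Real.exp (-(r * t)) : ℂ)‖ : ℝ) : ℂ) := by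
    intro t ht
    have : (t : ℂ) ^ n * (Real.exp (-(r * t)) : ℂ) = ((t ^ n * Real.exp (-(r * t)) : ℝ) : ℂ) := by
      push_cast; rfl
    rw [this, Complex.norm_real, Real.norm_of_nonneg]
    exact mul_nonneg (pow_nonneg (le_of_lt ht) _) (Real.exp_pos _).le
  rw [setIntegral_congr_fun measurableSet_Ioi e, integral_complex_ofReal] at h
  exact_mod_cast h

/-- Averaging `e^{-wρ}` over dilations with weight `v ^ j e^{-v}` gives
`j! / (1 + wρ) ^ (j + 1)`. -/
theorem integral_pow_mul_expSuperposition {X : Type*} [MeasurableSpace X] {m : Measure X}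
    [SFinite m] {ρ : X → ℝ} {f : X → ℂ} (hf : AEStronglyMeasurable f m) (hρ : Measurable ρ)
    (hpos : ∀ᵐ x ∂m, 0 < ρ x) {w : ℝ} (hw : 0 < w)
    (hfw : Integrable (fun x => f x / (1 + w * ρ x : ℝ)) m) (j : ℕ) :
    Integrable (fun x => f x / ((1 + w * ρ x : ℝ) : ℂ) ^ (j + 1)) m ∧
    IntegrableOn (fun v : ℝ => (v : ℂ) ^ j * (Real.exp (-v) : ℂ) *
      expSuperposition m ρ f (v * w)) (Ioi 0) ∧
    ∫ v in Ioi (0 : ℝ), (v : ℂ) ^ j * (Real.exp (-v) : ℂ) * expSuperposition m ρ f (v * w) =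
      j ! * ∫ x, f x / ((1 + w * ρ x : ℝ) : ℂ) ^ (j + 1) ∂m := by
  have hjm : Measurable fun x => ((1 + w * ρ x : ℝ) : ℂ) :=
    Complex.measurable_ofReal.comp ((hρ.const_mul w).const_add 1)
  have hint1 : Integrable (fun x => f x / ((1 + w * ρ x : ℝ) : ℂ) ^ (j + 1)) m := by
    refine hfw.mono (hf.div₀ (hjm.pow_const (j + 1)).aestronglyMeasurable) ?_
    filter_upwards [hpos] with x hx
    have h1 : (1 : ℝ) ≤ 1 + w * ρ x := by nlinarith
    rw [norm_div, norm_div, norm_pow, Complex.norm_real, Real.norm_of_nonneg (by linarith)]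
    exact div_le_div_of_nonneg_left (norm_nonneg _) (by linarith)
      (le_self_pow₀ h1 (Nat.succ_ne_zero j))
  set F : X × ℝ → ℂ := fun p => f p.1 *
    ((p.2 : ℂ) ^ j * (Real.exp (-((1 + w * ρ p.1) * p.2)) : ℂ)) with hF
  have hmeas : AEStronglyMeasurable F (m.prod (volume.restrict (Ioi 0))) := by
    refine hf.comp_fst.mul (Measurable.aestronglyMeasurable ?_)
    refine ((Complex.measurable_ofReal.comp measurable_snd).pow_const j).mul ?_
    exact Complex.measurable_ofReal.comp (Real.measurable_exp.comp
      ((((hρ.comp measurable_fst).const_mul w).const_add 1).mul measurable_snd).neg)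
  have hint : Integrable F (m.prod (volume.restrict (Ioi 0))) := by
    rw [integrable_prod_iff hmeas]
    constructor
    · filter_upwards [hpos] with x hx
      exact (integrableOn_pow_mul_exp_neg_mul j (r := 1 + w * ρ x) (by positivity)).const_mul (f x)
    · refine (hint1.norm.const_mul (j ! : ℝ)).congr ?_
      filter_upwards [hpos] with x hx
      have h1 : (0 : ℝ) < 1 + w * ρ x := by positivity
      simp only [hF, norm_mul (f x)]
      rw [integral_const_mul, integral_norm_pow_mul_exp_neg_mul j h1, norm_div, norm_pow,
        Complex.norm_real, Real.norm_of_nonneg h1.le]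
      ring
  have e : ∀ v : ℝ, (v : ℂ) ^ j * (Real.exp (-v) : ℂ) * expSuperposition m ρ f (v * w) =
      ∫ x, F (x, v) ∂m := by
    intro v
    rw [expSuperposition, ← integral_const_mul]
    refine integral_congr_ae (Filter.Eventually.of_forall fun x => ?_)
    have : Real.exp (-((1 + w * ρ x) * v)) = Real.exp (-v) * Real.exp (-(v * w * ρ x)) := by
      rw [← Real.exp_add]; ring_nf
    simp only [hF]
    rw [this]
    push_cast
    ring
  simp only [e]
  refine ⟨hint1, hint.integral_prod_right, ?_⟩
  rw [integral_integral_swap (f := fun v x => F (x, v)) hint.swap, ← integral_const_mul]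
  refine integral_congr_ae ?_
  filter_upwards [hpos] with x hx
  have h1 : (0 : ℝ) < 1 + w * ρ x := by positivity
  simp only [hF]
  rw [integral_const_mul, integral_pow_mul_exp_neg_mul j h1]
  ring

/-- A Beta integral, `∫ w ^ (n - b) / (1 + w) ^ (n + 1) dw = B(n + 1 - b, b)`. -/
theorem integral_cpow_neg_mul_pow_div {b : ℂ} {n : ℕ} (hb0 : 0 < b.re) (hbn : b.re < n + 1) :
    IntegrableOn (fun w : ℝ => (w : ℂ) ^ (-b) * ((w : ℂ) ^ n / ((1 + w : ℝ) : ℂ) ^ (n + 1)))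
      (Ioi 0) ∧
    ∫ w in Ioi (0 : ℝ), (w : ℂ) ^ (-b) * ((w : ℂ) ^ n / ((1 + w : ℝ) : ℂ) ^ (n + 1)) =
      Complex.Gamma b * Complex.Gamma (n + 1 - b) / n ! := by
  have hn : (n ! : ℂ) ≠ 0 := by exact_mod_cast n.factorial_ne_zero
  have hre : 0 < (n + 1 - b : ℂ).re := by simp; linarith
  have hT : StronglyMeasurable fun z : ℝ => (z : ℂ) ^ n * (Real.exp (-z) : ℂ) :=
    Continuous.stronglyMeasurable (by fun_prop)
  have eT : ∀ z ∈ Ioi (0 : ℝ), (z : ℂ) ^ ((n + 1 - b : ℂ) - 1) * (Real.exp (-(1 * z)) : ℂ) =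
      (z : ℂ) ^ (-b) * ((z : ℂ) ^ n * (Real.exp (-z) : ℂ)) := by
    intro z hz
    have hz' : (z : ℂ) ≠ 0 := by exact_mod_cast (ne_of_gt hz)
    rw [show (n + 1 - b : ℂ) - 1 = -b + n by ring, Complex.cpow_add _ _ hz', Complex.cpow_natCast,
      one_mul, mul_assoc]
  have eχ : ∀ v : ℝ, (v : ℂ) ^ (b - 1) * (Real.exp (-(1 * v)) : ℂ) =
      (Real.exp (-v) : ℂ) * (v : ℂ) ^ (b - 1) := fun v => by rw [one_mul, mul_comm]
  have h1 := integrableOn_cpow_mul_exp_neg_mul hb0 one_pos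
  have h2 := integral_cpow_mul_exp_neg_mul hb0 one_pos
  have h3 := (integrableOn_cpow_mul_exp_neg_mul hre one_pos).congr_fun eT measurableSet_Ioi
  have h4 := integral_cpow_mul_exp_neg_mul hre one_pos
  rw [setIntegral_congr_fun measurableSet_Ioi eT] at h4
  simp only [eχ] at h1 h2
  obtain ⟨k1, k2⟩ := integral_cpow_mul_integral_dilate (volume.restrict (Ioi (0 : ℝ)))
    (χ := fun v => (Real.exp (-v) : ℂ)) (s := fun v => v)
    (Continuous.aestronglyMeasurable (by fun_prop)) measurable_id
    (ae_restrict_mem measurableSet_Ioi) hT b h1 h3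
  have e : ∀ w ∈ Ioi (0 : ℝ), (w : ℂ) ^ (-b) * ∫ v in Ioi (0 : ℝ), (Real.exp (-v) : ℂ) *
      (((v * w : ℝ) : ℂ) ^ n * (Real.exp (-(v * w)) : ℂ)) =
      n ! * ((w : ℂ) ^ (-b) * ((w : ℂ) ^ n / ((1 + w : ℝ) : ℂ) ^ (n + 1))) := by
    intro w hw
    have hw1 : (0 : ℝ) < 1 + w := by have : (0 : ℝ) < w := hw; linarith
    have : ∀ v : ℝ, (Real.exp (-v) : ℂ) * (((v * w : ℝ) : ℂ) ^ n * (Real.exp (-(v * w)) : ℂ)) =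
        (w : ℂ) ^ n * ((v : ℂ) ^ n * (Real.exp (-((1 + w) * v)) : ℂ)) := by
      intro v
      rw [show -((1 + w) * v) = -v + -(v * w) by ring, Real.exp_add]
      push_cast
      ring
    simp only [this]
    rw [integral_const_mul, integral_pow_mul_exp_neg_mul n hw1]
    ring
  rw [setIntegral_congr_fun measurableSet_Ioi e, integral_const_mul, h2, h4] at k2
  have k3 := (k1.congr_fun e measurableSet_Ioi).const_mul ((n ! : ℂ)⁻¹)
  constructor
  · refine IntegrableOn.congr_fun k3 (fun w _ => ?_) measurableSet_Ioi
    rw [inv_mul_cancel_left₀ hn]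
  · rw [eq_div_iff hn, mul_comm _ (n ! : ℂ), k2]
    simp

/-- The two situations in which the kernel `1 / (1 + wρ)` is absolutely integrable against `f`:
it is at most `(wρ) ^ (Re b - 1)` for `0 ≤ Re b ≤ 1`, and at most `1` always. -/
theorem integrable_div_one_add_mul {X : Type*} [MeasurableSpace X] {m : Measure X} {ρ : X → ℝ}
    {f : X → ℂ} (hf : AEStronglyMeasurable f m) (hρ : Measurable ρ) (hpos : ∀ᵐ x ∂m, 0 < ρ x)
    {b : ℂ} (hfb : Integrable (fun x => f x * (ρ x : ℂ) ^ (b - 1)) m) (hb0 : 0 ≤ b.re)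
    (hf1 : b.re < 1 ∨ Integrable f m) {w : ℝ} (hw : 0 < w) :
    Integrable (fun x => f x / (1 + w * ρ x : ℝ)) m := by
  have hm : AEStronglyMeasurable (fun x => f x / (1 + w * ρ x : ℝ)) m :=
    hf.div₀ (Complex.measurable_ofReal.comp ((hρ.const_mul w).const_add 1)).aestronglyMeasurable
  rcases hf1 with hb1 | hf1
  · refine (hfb.norm.const_mul (w ^ (b.re - 1))).mono' hm ?_
    filter_upwards [hpos] with x hx
    have hz : 0 < w * ρ x := mul_pos hw hx
    have h1 : (0 : ℝ) < 1 + w * ρ x := by positivity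
    rw [norm_div, norm_mul, Complex.norm_real, Real.norm_of_nonneg h1.le,
      Complex.norm_cpow_eq_rpow_re_of_pos hx, mul_left_comm, Complex.sub_re, Complex.one_re,
      ← Real.mul_rpow hw.le hx.le, div_eq_mul_inv]
    refine mul_le_mul_of_nonneg_left ?_ (norm_nonneg _)
    rw [← Real.rpow_neg_one]
    calc (1 + w * ρ x) ^ (-1 : ℝ) ≤ (1 + w * ρ x) ^ (b.re - 1) :=
          Real.rpow_le_rpow_of_exponent_le (by linarith) (by linarith)
      _ ≤ (w * ρ x) ^ (b.re - 1) :=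
          Real.rpow_le_rpow_of_nonpos hz (by linarith) (by linarith)
  · refine hf1.mono hm ?_
    filter_upwards [hpos] with x hx
    have h1 : (1 : ℝ) ≤ 1 + w * ρ x := by nlinarith
    rw [norm_div, Complex.norm_real, Real.norm_of_nonneg (by linarith)]
    exact div_le_self (norm_nonneg _) h1

theorem integrable_mul_exp_neg_of_div_one_add {X : Type*} [MeasurableSpace X] {m : Measure X}
    {ρ : X → ℝ} {f : X → ℂ} (hf : AEStronglyMeasurable f m) (hρ : Measurable ρ)
    (hpos : ∀ᵐ x ∂m, 0 < ρ x) {w : ℝ} (hw : 0 < w)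
    (h : Integrable (fun x => f x / (1 + w * ρ x : ℝ)) m) :
    Integrable (fun x => f x * (Real.exp (-(w * ρ x)) : ℂ)) m := by
  refine h.mono (hf.mul (Complex.measurable_ofReal.comp
    (Real.measurable_exp.comp (hρ.const_mul w).neg)).aestronglyMeasurable) ?_
  filter_upwards [hpos] with x hx
  have h1 : (0 : ℝ) < 1 + w * ρ x := by positivity
  rw [norm_div, norm_mul, Complex.norm_real, Complex.norm_real, Real.norm_of_nonneg h1.le,
    Real.norm_of_nonneg (Real.exp_pos _).le, div_eq_mul_inv, Real.exp_neg]
  gcongr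
  linarith [Real.add_one_le_exp (w * ρ x)]

/-- Formally `∫ w ^ (-b) e^{-wρ} dw = Γ(1 - b) ρ ^ (b - 1)`; this holds under the integral sign
even for `1 ≤ Re b`, where the left-hand integral diverges, as soon as the superposition itself
has an absolutely convergent moment. The moment is compared with that of the Laguerre averages
`∫ L_n(v) e^{-v} T(v w) dv`, whose kernel `(wρ)ⁿ / (1 + wρ)ⁿ⁺¹` vanishes to order `n` at `w = 0`. -/
theorem integral_cpow_neg_mul_expSuperposition {X : Type*} [MeasurableSpace X] {m : Measure X}
    [SFinite m] {ρ : X → ℝ} {f : X → ℂ} (hf : AEStronglyMeasurable f m) (hρ : Measurable ρ)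
    (hpos : ∀ᵐ x ∂m, 0 < ρ x) {b : ℂ} (hb0 : 0 < b.re) (hb : ∀ n : ℕ, 1 - b ≠ -(n : ℂ))
    (hfb : Integrable (fun x => f x * (ρ x : ℂ) ^ (b - 1)) m)
    (hf1 : b.re < 1 ∨ Integrable f m)
    (hI : IntegrableOn (fun w : ℝ => (w : ℂ) ^ (-b) * expSuperposition m ρ f w) (Ioi 0)) :
    ∫ w in Ioi (0 : ℝ), (w : ℂ) ^ (-b) * expSuperposition m ρ f w =
      Complex.Gamma (1 - b) * ∫ x, f x * (ρ x : ℂ) ^ (b - 1) ∂m := by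
  have hT := stronglyMeasurable_expSuperposition hf hρ
  have hfw : ∀ w : ℝ, 0 < w → Integrable (fun x => f x / (1 + w * ρ x : ℝ)) m :=
    fun w hw => integrable_div_one_add_mul hf hρ hpos hfb (by linarith) hf1 hw
  obtain ⟨n, hn⟩ := exists_nat_gt b.re
  set I := ∫ w in Ioi (0 : ℝ), (w : ℂ) ^ (-b) * expSuperposition m ρ f w with hIdef
  have hfac (j : ℕ) : (j ! : ℂ) ≠ 0 := by exact_mod_cast j.factorial_ne_zero
  -- the averages of the superposition against `v ^ j e^{-v}`
  have step : ∀ j : ℕ, IntegrableOn (fun w : ℝ => (w : ℂ) ^ (-b) *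
        ∫ x, f x / ((1 + w * ρ x : ℝ) : ℂ) ^ (j + 1) ∂m) (Ioi 0) ∧
      ∫ w in Ioi (0 : ℝ), (w : ℂ) ^ (-b) * ∫ x, f x / ((1 + w * ρ x : ℝ) : ℂ) ^ (j + 1) ∂m =
        Complex.Gamma (b + j) / j ! * I := by
    intro j
    have hre : 0 < (b + j).re := by
      rw [Complex.add_re, Complex.natCast_re]; positivity
    have eχ : ∀ v ∈ Ioi (0 : ℝ), (v : ℂ) ^ (b + j - 1) * (Real.exp (-(1 * v)) : ℂ) =
        (v : ℂ) ^ j * (Real.exp (-v) : ℂ) * (v : ℂ) ^ (b - 1) := by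
      intro v hv
      have hv' : (v : ℂ) ≠ 0 := by exact_mod_cast (ne_of_gt hv)
      rw [show b + j - 1 = b - 1 + j by ring, Complex.cpow_add _ _ hv', Complex.cpow_natCast,
        one_mul]
      ring
    have h1 := (integrableOn_cpow_mul_exp_neg_mul hre one_pos).congr_fun eχ measurableSet_Ioi
    have h2 := integral_cpow_mul_exp_neg_mul hre one_pos
    rw [setIntegral_congr_fun measurableSet_Ioi eχ] at h2
    obtain ⟨k1, k2⟩ := integral_cpow_mul_integral_dilate (volume.restrict (Ioi (0 : ℝ)))
      (χ := fun v => (v : ℂ) ^ j * (Real.exp (-v) : ℂ)) (s := fun v => v)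
      (Continuous.aestronglyMeasurable (by fun_prop)) measurable_id
      (ae_restrict_mem measurableSet_Ioi) hT b h1 hI
    have e : ∀ w ∈ Ioi (0 : ℝ), (w : ℂ) ^ (-b) * ∫ v in Ioi (0 : ℝ),
        (v : ℂ) ^ j * (Real.exp (-v) : ℂ) * expSuperposition m ρ f (v * w) =
        j ! * ((w : ℂ) ^ (-b) * ∫ x, f x / ((1 + w * ρ x : ℝ) : ℂ) ^ (j + 1) ∂m) := by
      intro w hw
      rw [(integral_pow_mul_expSuperposition hf hρ hpos hw (hfw w hw) j).2.2]
      ring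
    rw [setIntegral_congr_fun measurableSet_Ioi e, integral_const_mul, h2] at k2
    have k3 := (k1.congr_fun e measurableSet_Ioi).const_mul ((j ! : ℂ)⁻¹)
    constructor
    · refine IntegrableOn.congr_fun k3 (fun w _ => ?_) measurableSet_Ioi
      rw [inv_mul_cancel_left₀ (hfac j)]
    · rw [div_mul_eq_mul_div, eq_div_iff (hfac j), mul_comm _ (j ! : ℂ), k2]
      simp [hIdef]
  obtain ⟨Q1, Q2⟩ := integral_cpow_neg_mul_pow_div (b := b) (n := n) hb0 (by linarith)
  have hQ : StronglyMeasurable fun w : ℝ => (w : ℂ) ^ n / ((1 + w : ℝ) : ℂ) ^ (n + 1) := by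
    refine Measurable.stronglyMeasurable ?_
    exact (Complex.measurable_ofReal.pow_const n).div
      ((Complex.measurable_ofReal.comp (measurable_id.const_add 1)).pow_const (n + 1))
  obtain ⟨-, q2⟩ := integral_cpow_mul_integral_dilate m hf hρ hpos hQ b hfb Q1
  -- the Laguerre combination of the averages, by the binomial theorem
  have eQ : ∀ w ∈ Ioi (0 : ℝ), (w : ℂ) ^ (-b) * ∫ x, f x * (((ρ x * w : ℝ) : ℂ) ^ n /
        ((1 + ρ x * w : ℝ) : ℂ) ^ (n + 1)) ∂m =
      ∑ j ∈ Finset.range (n + 1), (n.choose j : ℂ) * (-1) ^ j *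
        ((w : ℂ) ^ (-b) * ∫ x, f x / ((1 + w * ρ x : ℝ) : ℂ) ^ (j + 1) ∂m) := by
    intro w hw
    have hint j := (integral_pow_mul_expSuperposition hf hρ hpos hw (hfw w hw) j).1
    have : ∀ᵐ x ∂m, f x * (((ρ x * w : ℝ) : ℂ) ^ n / ((1 + ρ x * w : ℝ) : ℂ) ^ (n + 1)) =
        ∑ j ∈ Finset.range (n + 1), (n.choose j : ℂ) * (-1) ^ j *
          (f x / ((1 + w * ρ x : ℝ) : ℂ) ^ (j + 1)) := by
      filter_upwards [hpos] with x hx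
      have hw' : (0 : ℝ) < w := hw
      have h1 : ((1 + w * ρ x : ℝ) : ℂ) ≠ 0 := by
        exact_mod_cast (by positivity : (0 : ℝ) < 1 + w * ρ x).ne'
      rw [mul_comm (ρ x) w]
      set c := ((1 + w * ρ x : ℝ) : ℂ) with hc
      have hz : ((w * ρ x : ℝ) : ℂ) = -1 + c := by rw [hc]; push_cast; ring
      rw [hz, add_pow, ← mul_div_assoc, Finset.mul_sum, Finset.sum_div]
      refine Finset.sum_congr rfl fun j hj => ?_
      have hj' : j ≤ n := Nat.lt_succ_iff.mp (Finset.mem_range.mp hj)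
      have : c ^ (n + 1) = c ^ (n - j) * c ^ (j + 1) := by
        rw [← pow_add]; congr 1; omega
      rw [this]
      field_simp
    rw [integral_congr_ae this, integral_finsetSum _ fun j _ => (hint j).const_mul _,
      Finset.mul_sum]
    refine Finset.sum_congr rfl fun j _ => ?_
    rw [integral_const_mul]
    ring
  rw [setIntegral_congr_fun measurableSet_Ioi eQ,
    integral_finsetSum _ fun j _ => (step j).1.const_mul _] at q2
  simp only [integral_const_mul, (step _).2] at q2
  rw [Q2] at q2
  have hb' : ∀ k : ℕ, b ≠ -(k : ℂ) := by
    intro k hk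
    rw [hk] at hb0
    simp at hb0
    linarith [k.cast_nonneg (α := ℝ)]
  have S := sum_choose_mul_Gamma hb' n
  have S2 : ∑ j ∈ Finset.range (n + 1), (n.choose j : ℂ) * (-1) ^ j *
      (Complex.Gamma (b + j) / j ! * I) =
      Complex.Gamma b * (ascPochhammer ℂ n).eval (1 - b) / n ! * I := by
    rw [← S, Finset.sum_mul]
    refine Finset.sum_congr rfl fun j _ => ?_
    ring
  rw [S2, show (n + 1 - b : ℂ) = 1 - b + n by ring, Gamma_add_natCast hb] at q2
  have hG : Complex.Gamma b ≠ 0 := Complex.Gamma_ne_zero_of_re_pos hb0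
  have hP : (ascPochhammer ℂ n).eval (1 - b) ≠ 0 := by
    intro h
    have h2 := Gamma_add_natCast hb n
    rw [h, zero_mul] at h2
    refine Complex.Gamma_ne_zero_of_re_pos ?_ h2
    simp
    linarith
  have := hfac n
  field_simp at q2
  linear_combination q2

/-! ### The Macdonald function -/

/-- The heat-kernel form `∫₀^∞ τ^{ν-1} exp (-τ - z / (4τ)) dτ` of the Macdonald function; at
`z = x²` it equals `2^{1-ν} x^ν K_ν(x)`. -/
noncomputable def heatMacdonald (ν : ℂ) (z : ℝ) : ℂ :=
  ∫ τ in Ioi (0 : ℝ), (τ : ℂ) ^ (ν - 1) * (Real.exp (-(τ + z / (4 * τ))) : ℂ)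

theorem norm_cpow_mul_exp {τ : ℝ} (hτ : 0 < τ) (a : ℂ) (x : ℝ) :
    ‖(τ : ℂ) ^ a * (Real.exp x : ℂ)‖ = τ ^ a.re * Real.exp x := by
  rw [norm_mul, Complex.norm_cpow_eq_rpow_re_of_pos hτ, Complex.norm_real,
    Real.norm_of_nonneg (Real.exp_pos _).le]

theorem measurable_heatMacdonald_integrand (a : ℂ) (z : ℝ) :
    Measurable fun τ : ℝ => (τ : ℂ) ^ a * (Real.exp (-(τ + z / (4 * τ))) : ℂ) := by
  refine (measurable_ofReal_cpow _).mul (Complex.measurable_ofReal.comp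
    (Real.measurable_exp.comp ?_))
  exact (measurable_id.add (measurable_const.div (measurable_id.const_mul 4))).neg

theorem integrableOn_heatMacdonald (a : ℂ) {z : ℝ} (hz : 0 < z) :
    IntegrableOn (fun τ : ℝ => (τ : ℂ) ^ (a - 1) * (Real.exp (-(τ + z / (4 * τ))) : ℂ))
      (Ioi 0) := by
  -- the factor `exp (-z / (4τ))` beats any negative power of `τ` at the origin
  obtain ⟨N, hN⟩ := exists_nat_gt (-a.re)
  have h := (integrableOn_cpow_mul_exp_neg_mul (a := a + N) (by simp; linarith)
    one_pos).norm.const_mul (N ! * (4 / z) ^ N)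
  refine h.mono' (measurable_heatMacdonald_integrand _ z).aestronglyMeasurable ?_
  filter_upwards [ae_restrict_mem measurableSet_Ioi] with τ hτ
  have hτ' : (0 : ℝ) < τ := hτ
  rw [norm_cpow_mul_exp hτ', norm_cpow_mul_exp hτ', neg_add, Real.exp_add]
  have hy : 0 < z / (4 * τ) := by positivity
  have h1 := Real.pow_div_factorial_le_exp _ hy.le N
  have h2 : Real.exp (-(z / (4 * τ))) ≤ N ! * (4 / z) ^ N * τ ^ N := by
    rw [Real.exp_neg]
    refine (inv_anti₀ (by positivity) h1).trans (le_of_eq ?_)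
    rw [inv_div, mul_assoc, ← mul_pow, div_eq_mul_inv, ← inv_pow]
    congr 2
    field_simp
  have h3 : τ ^ (a + N - 1).re = τ ^ (a - 1).re * τ ^ N := by
    rw [← Real.rpow_add_natCast hτ'.ne']; congr 1; simp; ring
  calc τ ^ (a - 1).re * (Real.exp (-τ) * Real.exp (-(z / (4 * τ))))
      ≤ τ ^ (a - 1).re * (Real.exp (-τ) * (N ! * (4 / z) ^ N * τ ^ N)) := by gcongr
    _ = _ := by rw [h3, one_mul]; ring

theorem stronglyMeasurable_heatMacdonald (ν : ℂ) : StronglyMeasurable (heatMacdonald ν) := by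
  refine StronglyMeasurable.integral_prod_right
    (f := fun (z τ : ℝ) => (τ : ℂ) ^ (ν - 1) * (Real.exp (-(τ + z / (4 * τ))) : ℂ)) ?_
  refine Measurable.stronglyMeasurable ?_
  refine ((measurable_ofReal_cpow _).comp measurable_snd).mul (Complex.measurable_ofReal.comp
    (Real.measurable_exp.comp ?_))
  exact (measurable_snd.add (measurable_fst.div (measurable_snd.const_mul 4))).neg

theorem heatMacdonald_sq (ν : ℂ) {x : ℝ} (hx : 0 < x) :
    heatMacdonald ν (x ^ 2) = 2 * ((x / 2 : ℝ) : ℂ) ^ ν * macdonaldK ν x := by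
  -- the substitution `τ = (x / 2) e^t` turns `τ + x² / (4τ)` into `x cosh t`
  have himg : (fun t : ℝ => x / 2 * Real.exp t) '' univ = Ioi 0 := by
    ext τ
    constructor
    · rintro ⟨t, -, rfl⟩
      exact mul_pos (by positivity) (Real.exp_pos t)
    · intro hτ
      have hτ' : (0 : ℝ) < τ := hτ
      refine ⟨Real.log (τ / (x / 2)), mem_univ _, ?_⟩
      simp only
      rw [Real.exp_log (by positivity)]
      field_simp
  have hder : ∀ t ∈ (univ : Set ℝ), HasDerivWithinAt (fun t : ℝ => x / 2 * Real.exp t)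
      (x / 2 * Real.exp t) univ t := fun t _ =>
    ((Real.hasDerivAt_exp t).const_mul (x / 2)).hasDerivWithinAt
  have hinj : InjOn (fun t : ℝ => x / 2 * Real.exp t) univ := by
    intro s _ t _ h
    have : x / 2 ≠ 0 := by positivity
    exact Real.exp_injective (mul_left_cancel₀ this h)
  set G : ℝ → ℂ := fun t => Complex.exp (ν * t) * (Real.exp (-x * Real.cosh t) : ℂ) with hG
  have hx2 : ((x / 2 : ℝ) : ℂ) ≠ 0 := by exact_mod_cast (by positivity : (0:ℝ) < x / 2).ne'
  have e : ∀ t : ℝ, |x / 2 * Real.exp t| • (((x / 2 * Real.exp t : ℝ) : ℂ) ^ (ν - 1) *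
      (Real.exp (-(x / 2 * Real.exp t + x ^ 2 / (4 * (x / 2 * Real.exp t)))) : ℂ)) =
      ((x / 2 : ℝ) : ℂ) ^ ν * G t := by
    intro t
    have hpos : 0 < x / 2 * Real.exp t := mul_pos (by positivity) (Real.exp_pos t)
    have hne : ((x / 2 * Real.exp t : ℝ) : ℂ) ≠ 0 := by exact_mod_cast hpos.ne'
    have h1 : -(x / 2 * Real.exp t + x ^ 2 / (4 * (x / 2 * Real.exp t))) = -x * Real.cosh t := by
      rw [Real.cosh_eq, Real.exp_neg]
      have := (Real.exp_pos t).ne'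
      field_simp
      ring
    have h2 : ((x / 2 * Real.exp t : ℝ) : ℂ) ^ ν =
        ((x / 2 : ℝ) : ℂ) ^ ν * Complex.exp (ν * t) := by
      rw [Complex.ofReal_mul, Complex.mul_cpow_ofReal_nonneg (by positivity) (Real.exp_pos t).le,
        Complex.cpow_def_of_ne_zero (x := ((Real.exp t : ℝ) : ℂ))
          (by exact_mod_cast (Real.exp_pos t).ne'), ← Complex.ofReal_log (Real.exp_pos t).le,
        Real.log_exp, mul_comm (t : ℂ)]
    rw [abs_of_pos hpos, h1, Complex.real_smul, Complex.cpow_sub _ _ hne, Complex.cpow_one, h2, hG]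
    generalize ((x / 2 * Real.exp t : ℝ) : ℂ) = c at hne
    field_simp
  have hint : Integrable G := by
    have h := integrableOn_heatMacdonald ν (z := x ^ 2) (by positivity)
    rw [← himg, integrableOn_image_iff_integrableOn_abs_deriv_smul MeasurableSet.univ hder hinj,
      integrableOn_univ] at h
    simp only [e] at h
    have h' := h.const_mul ((((x / 2 : ℝ) : ℂ) ^ ν)⁻¹)
    refine h'.congr (Filter.Eventually.of_forall fun t => ?_)
    have : ((x / 2 : ℝ) : ℂ) ^ ν ≠ 0 := by simp [Complex.cpow_eq_zero_iff, hx.ne']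
    simp only
    rw [inv_mul_cancel_left₀ this]
  have hval : heatMacdonald ν (x ^ 2) = ((x / 2 : ℝ) : ℂ) ^ ν * ∫ t, G t := by
    rw [heatMacdonald, ← himg,
      integral_image_eq_integral_abs_deriv_smul MeasurableSet.univ hder hinj, setIntegral_univ]
    simp only [e]
    rw [integral_const_mul]
  have hsplit : ∫ t, G t = 2 * macdonaldK ν x := by
    rw [← intervalIntegral.integral_Iic_add_Ioi hint.integrableOn hint.integrableOn (b := (0 : ℝ))]
    have h0 := integral_comp_neg_Ioi (0 : ℝ) G
    rw [neg_zero] at h0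
    have hn : IntegrableOn (fun t => G (-t)) (Ioi 0) := hint.comp_neg.integrableOn
    rw [← h0, ← integral_add hn hint.integrableOn, macdonaldK, ← integral_const_mul]
    refine integral_congr_ae (Filter.Eventually.of_forall fun t => ?_)
    simp only [hG, Real.cosh_neg, Complex.cosh]
    push_cast
    ring_nf
  rw [hval, hsplit]
  ring

theorem macdonaldK_neg (ν : ℂ) (x : ℝ) : macdonaldK (-ν) x = macdonaldK ν x := by
  simp [macdonaldK, neg_mul, Complex.cosh_neg]

/-- The symmetry `K_ν = K_{-ν}`. -/
theorem heatMacdonald_eq_cpow_mul_neg (ν : ℂ) {z : ℝ} (hz : 0 < z) :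
    heatMacdonald ν z = ((z / 4 : ℝ) : ℂ) ^ ν * heatMacdonald (-ν) z := by
  have hx : 0 < Real.sqrt z := Real.sqrt_pos.mpr hz
  have h1 := heatMacdonald_sq ν hx
  have h2 := heatMacdonald_sq (-ν) hx
  rw [Real.sq_sqrt hz.le] at h1 h2
  rw [macdonaldK_neg] at h2
  have h4 : z / 4 = (Real.sqrt z / 2) * (Real.sqrt z / 2) := by
    nlinarith [Real.sq_sqrt hz.le]
  have hne : ((Real.sqrt z / 2 : ℝ) : ℂ) ≠ 0 := by
    exact_mod_cast (by positivity : (0 : ℝ) < Real.sqrt z / 2).ne'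
  have h5 : ((Real.sqrt z / 2 : ℝ) : ℂ) ^ ν * ((Real.sqrt z / 2 : ℝ) : ℂ) ^ (-ν) = 1 := by
    rw [← Complex.cpow_add _ _ hne]; simp
  rw [h1, h2, h4, Complex.ofReal_mul,
    Complex.mul_cpow_ofReal_nonneg (by positivity) (by positivity)]
  linear_combination (-2 * ((Real.sqrt z / 2 : ℝ) : ℂ) ^ ν * macdonaldK ν (Real.sqrt z)) * h5

theorem norm_heatMacdonald_le {ν : ℂ} (hν : 0 < ν.re) {z : ℝ} (hz : 0 ≤ z) :
    ‖heatMacdonald ν z‖ ≤ Real.Gamma ν.re := by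
  rw [Real.Gamma_eq_integral hν, heatMacdonald]
  refine norm_integral_le_of_norm_le (Real.GammaIntegral_convergent hν) ?_
  filter_upwards [ae_restrict_mem measurableSet_Ioi] with τ hτ
  have hτ' : (0 : ℝ) < τ := hτ
  have : 0 ≤ z / (4 * τ) := by positivity
  rw [norm_cpow_mul_exp hτ', mul_comm, Complex.sub_re, Complex.one_re]
  gcongr
  linarith

/-- As `z → 0` the value `Γ(ν)` is approached, which is not zero. -/
theorem exists_le_norm_heatMacdonald {ν : ℂ} (hν : 0 < ν.re) :
    ∃ δ > 0, ∃ c > 0, ∀ z, 0 < z → z < δ → c ≤ ‖heatMacdonald ν z‖ := by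
  have hlim : Filter.Tendsto (heatMacdonald ν) (nhdsWithin 0 (Ioi 0))
      (nhds (∫ τ in Ioi (0 : ℝ), (τ : ℂ) ^ (ν - 1) * (Real.exp (-(τ + 0 / (4 * τ))) : ℂ))) := by
    refine tendsto_integral_filter_of_dominated_convergence
      (fun τ : ℝ => Real.exp (-τ) * τ ^ (ν.re - 1)) ?_ ?_ (Real.GammaIntegral_convergent hν) ?_
    · exact Filter.Eventually.of_forall fun z =>
        (measurable_heatMacdonald_integrand _ z).aestronglyMeasurable
    · filter_upwards [self_mem_nhdsWithin] with z hz
      have hz' : (0 : ℝ) < z := hz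
      filter_upwards [ae_restrict_mem measurableSet_Ioi] with τ hτ
      have hτ' : (0 : ℝ) < τ := hτ
      have : 0 ≤ z / (4 * τ) := by positivity
      rw [norm_cpow_mul_exp hτ', mul_comm, Complex.sub_re, Complex.one_re]
      gcongr
      linarith
    · filter_upwards with τ
      refine Filter.Tendsto.mono_left ?_ nhdsWithin_le_nhds
      refine Continuous.tendsto (f := fun z : ℝ => (τ : ℂ) ^ (ν - 1) *
        (Real.exp (-(τ + z / (4 * τ))) : ℂ)) ?_ 0
      fun_prop
  have hval : (∫ τ in Ioi (0 : ℝ), (τ : ℂ) ^ (ν - 1) * (Real.exp (-(τ + 0 / (4 * τ))) : ℂ)) =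
      Complex.Gamma ν := by
    have := integral_cpow_mul_exp_neg_mul hν one_pos
    simpa using this
  rw [hval] at hlim
  have hG : 0 < ‖Complex.Gamma ν‖ := norm_pos_iff.mpr (Complex.Gamma_ne_zero_of_re_pos hν)
  have hev := hlim.norm.eventually (lt_mem_nhds (half_lt_self hG))
  rw [eventually_nhdsWithin_iff, Metric.eventually_nhds_iff] at hev
  obtain ⟨δ, hδ, h⟩ := hev
  refine ⟨δ, hδ, ‖Complex.Gamma ν‖ / 2, by positivity, fun z hz hzδ => (h ?_ hz).le⟩
  rwa [Real.dist_eq, sub_zero, abs_of_pos hz]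

theorem integrableOn_heatMacdonald_Ioi {ν : ℂ} (hν : -1 < ν.re) :
    IntegrableOn (heatMacdonald ν) (Ioi 0) := by
  set F : ℝ × ℝ → ℂ := fun p => (p.1 : ℂ) ^ (ν - 1) *
    (Real.exp (-(p.1 + p.2 / (4 * p.1))) : ℂ) with hF
  have hmeas : Measurable F := by
    refine ((measurable_ofReal_cpow _).comp measurable_fst).mul (Complex.measurable_ofReal.comp
      (Real.measurable_exp.comp ?_))
    exact (measurable_fst.add (measurable_snd.div (measurable_fst.const_mul 4))).neg
  have key : ∀ τ : ℝ, 0 < τ → ∀ z : ℝ, F (τ, z) = (τ : ℂ) ^ (ν - 1) * (Real.exp (-τ) : ℂ) *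
      ((z : ℂ) ^ 0 * (Real.exp (-(1 / (4 * τ) * z)) : ℂ)) := by
    intro τ hτ z
    simp only [hF]
    rw [show -(τ + z / (4 * τ)) = -τ + -(1 / (4 * τ) * z) by ring, Real.exp_add]
    push_cast
    ring
  have hint : Integrable F ((volume.restrict (Ioi 0)).prod (volume.restrict (Ioi 0))) := by
    rw [integrable_prod_iff hmeas.aestronglyMeasurable]
    constructor
    · filter_upwards [ae_restrict_mem measurableSet_Ioi] with τ hτ
      have hτ' : (0 : ℝ) < τ := hτ
      simp only [key τ hτ']
      exact (integrableOn_pow_mul_exp_neg_mul 0 (r := 1 / (4 * τ)) (by positivity)).const_mul _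
    · have h := ((integrableOn_cpow_mul_exp_neg_mul (a := ν + 1) (by simp; linarith)
        one_pos).norm.const_mul 4)
      refine h.congr ?_
      filter_upwards [ae_restrict_mem measurableSet_Ioi] with τ hτ
      have hτ' : (0 : ℝ) < τ := hτ
      simp only [key τ hτ', norm_mul ((τ : ℂ) ^ (ν - 1) * _)]
      rw [integral_const_mul, integral_norm_pow_mul_exp_neg_mul 0 (r := 1 / (4 * τ))
        (by positivity), norm_cpow_mul_exp hτ', norm_cpow_mul_exp hτ', add_sub_cancel_right,
        Complex.sub_re, Complex.one_re, Real.rpow_sub_one hτ'.ne', one_mul]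
      simp
      field_simp
  exact hint.integral_prod_right

/-- The three-term recurrence of the Macdonald function, on the imaginary axis of orders. -/
theorem heatMacdonald_add_one {ν : ℂ} (hν : ν.re = 0) {z : ℝ} (hz : 0 < z) :
    ν * heatMacdonald ν z =
      heatMacdonald (ν + 1) z - ((z / 4 : ℝ) : ℂ) * heatMacdonald (ν - 1) z := by
  set E : ℝ → ℂ := fun τ => (Real.exp (-(τ + z / (4 * τ))) : ℂ) with hE
  set E' : ℝ → ℂ := fun τ => (Real.exp (-(τ + z / (4 * τ))) * (-1 + z / 4 * (τ ^ 2)⁻¹) : ℝ) with hE'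
  have hdE : ∀ τ ∈ Ioi (0 : ℝ), HasDerivAt E (E' τ) τ := by
    intro τ hτ
    have hτ' : (τ : ℝ) ≠ 0 := ne_of_gt hτ
    have h1 : HasDerivAt (fun τ : ℝ => -(τ + z / 4 * τ⁻¹)) (-(1 + z / 4 * (-(τ ^ 2)⁻¹))) τ :=
      ((hasDerivAt_id τ).add ((hasDerivAt_inv hτ').const_mul (z / 4))).neg
    have h2 : (fun τ : ℝ => -(τ + z / 4 * τ⁻¹)) = fun τ => -(τ + z / (4 * τ)) := by
      funext s; rw [div_mul_eq_div_div, div_eq_mul_inv (z / 4)]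
    rw [h2] at h1
    have h3 := h1.exp.ofReal_comp
    convert h3 using 1
    simp only [hE']
    congr 2
    ring
  have hdv : ∀ τ ∈ Ioi (0 : ℝ), HasDerivAt (fun τ : ℝ => (τ : ℂ) ^ ν)
      (ν * (τ : ℂ) ^ (ν - 1)) τ := by
    intro τ hτ
    by_cases h0 : ν = 0
    · subst h0; simpa using hasDerivAt_const τ (1 : ℂ)
    · exact hasDerivAt_ofReal_cpow_const (ne_of_gt hτ) h0
  -- on the line `Re ν = 0` the product `E(τ) τ ^ ν` has the size of `E(τ)`
  have hnorm : ∀ τ ∈ Ioi (0 : ℝ), ‖(E * fun τ : ℝ => (τ : ℂ) ^ ν) τ‖ =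
      Real.exp (-(τ + z / (4 * τ))) := by
    intro τ hτ
    have := norm_cpow_mul_exp hτ ν (-(τ + z / (4 * τ)))
    rw [hν, Real.rpow_zero, one_mul, mul_comm] at this
    exact this
  have hlim0 : Filter.Tendsto (E * fun τ : ℝ => (τ : ℂ) ^ ν) (nhdsWithin 0 (Ioi 0)) (nhds 0) := by
    refine squeeze_zero_norm' (a := fun τ : ℝ => 4 / z * τ) ?_ ?_
    · filter_upwards [self_mem_nhdsWithin] with τ hτ
      have hτ' : (0 : ℝ) < τ := hτ
      have hy : 0 < z / (4 * τ) := by positivity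
      rw [hnorm τ hτ, Real.exp_neg, show 4 / z * τ = (z / (4 * τ))⁻¹ by field_simp]
      refine inv_anti₀ hy ?_
      linarith [Real.add_one_le_exp (τ + z / (4 * τ))]
    · have : Filter.Tendsto (fun τ : ℝ => 4 / z * τ) (nhds 0) (nhds (4 / z * 0)) :=
        Continuous.tendsto (by fun_prop) 0
      rw [mul_zero] at this
      exact this.mono_left nhdsWithin_le_nhds
  have hliminf : Filter.Tendsto (E * fun τ : ℝ => (τ : ℂ) ^ ν) Filter.atTop (nhds 0) := by
    refine squeeze_zero_norm' (a := fun τ : ℝ => Real.exp (-τ)) ?_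
      Real.tendsto_exp_neg_atTop_nhds_zero
    filter_upwards [Filter.eventually_gt_atTop 0] with τ hτ
    have : 0 ≤ z / (4 * τ) := by positivity
    rw [hnorm τ hτ]
    gcongr
    linarith
  have e1 : ∀ τ ∈ Ioi (0 : ℝ), (E' * fun τ : ℝ => (τ : ℂ) ^ ν) τ =
      -((τ : ℂ) ^ (ν + 1 - 1) * (Real.exp (-(τ + z / (4 * τ))) : ℂ)) + ((z / 4 : ℝ) : ℂ) *
        ((τ : ℂ) ^ (ν - 1 - 1) * (Real.exp (-(τ + z / (4 * τ))) : ℂ)) := by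
    intro τ hτ
    have hτ' : (τ : ℂ) ≠ 0 := by exact_mod_cast (ne_of_gt hτ)
    rw [add_sub_cancel_right, show ν - 1 - 1 = ν - (2 : ℕ) by push_cast; ring,
      Complex.cpow_sub _ _ hτ', Complex.cpow_natCast]
    simp only [hE', Pi.mul_apply]
    push_cast
    field_simp
  have e2 : ∀ τ : ℝ, (E * fun τ : ℝ => ν * (τ : ℂ) ^ (ν - 1)) τ =
      ν * ((τ : ℂ) ^ (ν - 1) * (Real.exp (-(τ + z / (4 * τ))) : ℂ)) := by
    intro τ
    simp only [hE, Pi.mul_apply]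
    ring
  have i1 := integrableOn_heatMacdonald (ν + 1) hz
  have i2 := (integrableOn_heatMacdonald (ν - 1) hz).const_mul ((z / 4 : ℝ) : ℂ)
  have h := integral_Ioi_mul_deriv_eq_deriv_mul hdE hdv
    (((integrableOn_heatMacdonald ν hz).const_mul ν).congr
      (Filter.Eventually.of_forall fun τ => (e2 τ).symm))
    (IntegrableOn.congr_fun (i1.neg.add i2) (fun τ hτ => (e1 τ hτ).symm) measurableSet_Ioi)
    hlim0 hliminf
  have h1 : ∫ τ in Ioi (0 : ℝ), E τ * (ν * (τ : ℂ) ^ (ν - 1)) = ν * heatMacdonald ν z := by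
    rw [heatMacdonald, ← integral_const_mul]
    exact integral_congr_ae (Filter.Eventually.of_forall fun τ => e2 τ)
  have h2 : ∫ τ in Ioi (0 : ℝ), E' τ * (τ : ℂ) ^ ν = -heatMacdonald (ν + 1) z +
      ((z / 4 : ℝ) : ℂ) * heatMacdonald (ν - 1) z := by
    refine (setIntegral_congr_fun measurableSet_Ioi e1).trans ?_
    refine (integral_add i1.neg i2).trans ?_
    rw [integral_const_mul]
    exact congrArg₂ (· + ·) (integral_neg _) rfl
  rw [h1, h2] at h
  linear_combination h

/-- For imaginary order `ν ≠ 0` the function oscillates near `0` but stays bounded: in the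
recurrence the order `ν - 1` is reflected to `1 - ν`, and both remaining orders have real part
`1`. -/
theorem norm_heatMacdonald_le_of_re_eq_zero {ν : ℂ} (hν : ν.re = 0) (h0 : ν ≠ 0) {z : ℝ}
    (hz : 0 < z) : ‖heatMacdonald ν z‖ ≤ 2 / ‖ν‖ := by
  have hn : 0 < ‖ν‖ := norm_pos_iff.mpr h0
  have hz4 : 0 < z / 4 := by positivity
  have hne : ((z / 4 : ℝ) : ℂ) ≠ 0 := by exact_mod_cast hz4.ne'
  rw [le_div_iff₀ hn, mul_comm, ← norm_mul, heatMacdonald_add_one hν hz,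
    heatMacdonald_eq_cpow_mul_neg (ν - 1) hz, ← mul_assoc]
  have h1 : ((z / 4 : ℝ) : ℂ) * ((z / 4 : ℝ) : ℂ) ^ (ν - 1) = ((z / 4 : ℝ) : ℂ) ^ ν := by
    rw [Complex.cpow_sub _ _ hne, Complex.cpow_one, mul_div_cancel₀ _ hne]
  have h2 : ‖heatMacdonald (ν + 1) z‖ ≤ 1 := by
    have := norm_heatMacdonald_le (ν := ν + 1) (by simp [hν]) hz.le
    simpa [hν] using this
  have h3 : ‖heatMacdonald (-(ν - 1)) z‖ ≤ 1 := by
    have := norm_heatMacdonald_le (ν := -(ν - 1)) (by simp [hν]) hz.le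
    simpa [hν] using this
  rw [h1]
  refine (norm_sub_le _ _).trans ?_
  rw [norm_mul, Complex.norm_cpow_eq_rpow_re_of_pos hz4, hν, Real.rpow_zero, one_mul]
  linarith

theorem norm_heatMacdonald_zero {z : ℝ} (hz : 0 < z) :
    IntegrableOn (fun τ : ℝ => τ ^ (-1 : ℝ) * Real.exp (-(τ + z / (4 * τ)))) (Ioi 0) ∧
    ‖heatMacdonald 0 z‖ = ∫ τ in Ioi (0 : ℝ), τ ^ (-1 : ℝ) * Real.exp (-(τ + z / (4 * τ))) := by
  have e : ∀ τ ∈ Ioi (0 : ℝ), (τ : ℂ) ^ ((0 : ℂ) - 1) * (Real.exp (-(τ + z / (4 * τ))) : ℂ) =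
      ((τ ^ (-1 : ℝ) * Real.exp (-(τ + z / (4 * τ))) : ℝ) : ℂ) := by
    intro τ hτ
    rw [zero_sub, Complex.ofReal_mul, Complex.ofReal_cpow (le_of_lt hτ)]
    simp
  constructor
  · refine IntegrableOn.congr_fun (integrableOn_heatMacdonald 0 hz).norm (fun τ hτ => ?_)
      measurableSet_Ioi
    rw [norm_cpow_mul_exp hτ]
    simp
  · rw [heatMacdonald, setIntegral_congr_fun measurableSet_Ioi e, integral_complex_ofReal,
      Complex.norm_real, Real.norm_of_nonneg]
    refine setIntegral_nonneg measurableSet_Ioi fun τ hτ => ?_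
    exact mul_nonneg (Real.rpow_nonneg (le_of_lt hτ) _) (Real.exp_pos _).le

/-- Order `0` has a logarithmic singularity, so dilation costs more than a constant factor; a power
of the ratio is a convenient majorant of the logarithm. -/
theorem heatMacdonald_zero_dilate {r z : ℝ} (hr : 0 < r) (hz : 0 < z) :
    ‖heatMacdonald 0 (r * z)‖ ≤
      Real.exp 1 * ‖heatMacdonald 0 z‖ + Real.Gamma (1 / 2) * r ^ (-(1 / 2) : ℝ) := by
  obtain ⟨i1, h1⟩ := norm_heatMacdonald_zero (mul_pos hr hz)
  obtain ⟨i2, h2⟩ := norm_heatMacdonald_zero hz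
  -- the substitution `τ ↦ r τ` moves the dilation onto the factor `e^{-τ}`
  have h3 := integral_comp_mul_left_Ioi
    (fun τ : ℝ => τ ^ (-1 : ℝ) * Real.exp (-(τ + r * z / (4 * τ)))) 0 hr
  rw [mul_zero, ← h1, smul_eq_mul, eq_inv_mul_iff_mul_eq₀ hr.ne', ← integral_const_mul] at h3
  have i4 : IntegrableOn (fun τ : ℝ => τ ^ ((1 / 2 : ℝ) - 1) * Real.exp (-(r * τ))) (Ioi 0) := by
    refine IntegrableOn.congr_fun (integrableOn_cpow_mul_exp_neg_mul (a := ((1 / 2 : ℝ) : ℂ))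
      (by simp) hr).norm (fun τ hτ => ?_) measurableSet_Ioi
    rw [norm_cpow_mul_exp hτ]
    simp
  have h4 := Real.integral_rpow_mul_exp_neg_mul_Ioi (a := 1 / 2) (by norm_num) hr
  rw [← h3, h2, show Real.Gamma (1 / 2) * r ^ (-(1 / 2) : ℝ) = (1 / r) ^ (1 / 2 : ℝ) *
    Real.Gamma (1 / 2) by rw [one_div r, Real.inv_rpow hr.le, Real.rpow_neg hr.le, mul_comm],
    ← h4, ← integral_const_mul, ← integral_add (i2.const_mul _) i4]
  refine setIntegral_mono_on ?_ ((i2.const_mul _).add i4) measurableSet_Ioi fun τ hτ => ?_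
  · refine Integrable.const_mul (f := fun τ : ℝ => (r * τ) ^ (-1 : ℝ) *
      Real.exp (-(r * τ + r * z / (4 * (r * τ))))) ?_ r
    exact (integrableOn_Ioi_comp_mul_left_iff
      (fun τ : ℝ => τ ^ (-1 : ℝ) * Real.exp (-(τ + r * z / (4 * τ)))) 0 hr).mpr (by simpa using i1)
  · have hτ' : (0 : ℝ) < τ := hτ
    have hy : 0 < z / (4 * τ) := by positivity
    have e : r * ((r * τ) ^ (-1 : ℝ) * Real.exp (-(r * τ + r * z / (4 * (r * τ))))) =
        τ ^ (-1 : ℝ) * Real.exp (-(r * τ + z / (4 * τ))) := by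
      rw [Real.rpow_neg_one, Real.rpow_neg_one,
        show r * z / (4 * (r * τ)) = z / (4 * τ) by field_simp]
      field_simp
    rw [e]
    have n1 : 0 ≤ Real.exp 1 * (τ ^ (-1 : ℝ) * Real.exp (-(τ + z / (4 * τ)))) := by positivity
    have n2 : 0 ≤ τ ^ ((1 / 2 : ℝ) - 1) * Real.exp (-(r * τ)) := by positivity
    rcases le_total τ 1 with h | h
    · refine le_trans ?_ (le_add_of_nonneg_right n2)
      rw [mul_left_comm, ← Real.exp_add]
      have : 0 ≤ r * τ := by positivity
      gcongr
      linarith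
    · refine le_trans ?_ (le_add_of_nonneg_left n1)
      have : τ ^ (-1 : ℝ) ≤ τ ^ ((1 / 2 : ℝ) - 1) :=
        Real.rpow_le_rpow_of_exponent_le h (by norm_num)
      gcongr
      linarith

/-- Dilating the argument costs at most a power of the ratio with exponent in `(-1, 0]`. For
`Re ν > 0`, or `Re ν = 0` and `ν ≠ 0`, the function is bounded; for `Re ν < 0` it is comparable to
`z ^ Re ν` near `0`. -/
theorem exists_norm_heatMacdonald_dilate_le {ν : ℂ} (hν : -1 < ν.re) :
    ∃ C p : ℝ, 0 ≤ C ∧ 0 ≤ p ∧ p < 1 ∧ ∀ r z : ℝ, 0 < r → 0 < z →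
      ‖heatMacdonald ν (r * z)‖ ≤ C * (1 + r ^ (-p)) * (1 + ‖heatMacdonald ν z‖) := by
  have key : ∀ C : ℝ, 0 ≤ C → (∀ z : ℝ, 0 < z → ‖heatMacdonald ν z‖ ≤ C) →
      ∃ C p : ℝ, 0 ≤ C ∧ 0 ≤ p ∧ p < 1 ∧ ∀ r z : ℝ, 0 < r → 0 < z →
        ‖heatMacdonald ν (r * z)‖ ≤ C * (1 + r ^ (-p)) * (1 + ‖heatMacdonald ν z‖) := by
    intro C hC h
    refine ⟨C, 0, hC, le_rfl, one_pos, fun r z hr hz => (h _ (mul_pos hr hz)).trans ?_⟩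
    rw [mul_assoc]
    refine le_mul_of_one_le_right hC ?_
    rw [neg_zero, Real.rpow_zero]
    nlinarith [norm_nonneg (heatMacdonald ν z)]
  rcases lt_trichotomy ν.re 0 with hneg | hzero | hpos
  · have hm : 0 < (-ν).re := by simpa using hneg
    obtain ⟨δ, hδ, c, hc, hδc⟩ := exists_le_norm_heatMacdonald hm
    have hG : 0 < Real.Gamma (-ν).re := Real.Gamma_pos_of_pos hm
    -- near `0` the power is controlled by the function itself, elsewhere by a constant
    have hA : ∀ z : ℝ, 0 < z → (z / 4) ^ ν.re ≤
        (1 / c + (δ / 4) ^ ν.re) * (1 + ‖heatMacdonald ν z‖) := by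
      intro z hz
      have hz4 : 0 < z / 4 := by positivity
      have hδ4 : 0 < (δ / 4) ^ ν.re := by positivity
      have hc1 : 0 < 1 / c := by positivity
      have hn := norm_nonneg (heatMacdonald ν z)
      rcases lt_or_ge z δ with h | h
      · have h1 := hδc z hz h
        have h2 : ‖heatMacdonald ν z‖ = (z / 4) ^ ν.re * ‖heatMacdonald (-ν) z‖ := by
          rw [heatMacdonald_eq_cpow_mul_neg ν hz, norm_mul,
            Complex.norm_cpow_eq_rpow_re_of_pos hz4]
        have h3 : (z / 4) ^ ν.re ≤ 1 / c * ‖heatMacdonald ν z‖ := by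
          rw [h2, one_div, inv_mul_eq_div, le_div_iff₀ hc]
          gcongr
        nlinarith
      · have h1 : (z / 4) ^ ν.re ≤ (δ / 4) ^ ν.re :=
          Real.rpow_le_rpow_of_nonpos (by positivity) (by linarith) hneg.le
        nlinarith
    refine ⟨Real.Gamma (-ν).re * (1 / c + (δ / 4) ^ ν.re), -ν.re, by positivity, by linarith,
      by linarith, fun r z hr hz => ?_⟩
    have hrz : 0 < r * z := mul_pos hr hz
    rw [heatMacdonald_eq_cpow_mul_neg ν hrz, norm_mul,
      Complex.norm_cpow_eq_rpow_re_of_pos (by positivity), mul_div_assoc,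
      Real.mul_rpow hr.le (by positivity), neg_neg]
    have h1 := norm_heatMacdonald_le hm hrz.le
    have h2 := hA z hz
    have h3 : r ^ ν.re ≤ 1 + r ^ ν.re := by linarith
    calc r ^ ν.re * (z / 4) ^ ν.re * ‖heatMacdonald (-ν) (r * z)‖
        ≤ (1 + r ^ ν.re) * ((1 / c + (δ / 4) ^ ν.re) * (1 + ‖heatMacdonald ν z‖)) *
          Real.Gamma (-ν).re := by gcongr
      _ = _ := by ring
  · by_cases h0 : ν = 0
    · subst h0
      refine ⟨Real.exp 1 + Real.Gamma (1 / 2), 1 / 2, ?_, by norm_num, by norm_num,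
        fun r z hr hz => (heatMacdonald_zero_dilate hr hz).trans ?_⟩
      · have := Real.Gamma_pos_of_pos (s := 1 / 2) (by norm_num)
        positivity
      · have hG := Real.Gamma_pos_of_pos (s := 1 / 2) (by norm_num)
        have he := Real.exp_pos 1
        have hn := norm_nonneg (heatMacdonald 0 z)
        have hr' : 0 < r ^ (-(1 / 2) : ℝ) := by positivity
        rw [show (Real.exp 1 + Real.Gamma (1 / 2)) * (1 + r ^ (-(1 / 2) : ℝ)) *
            (1 + ‖heatMacdonald 0 z‖) = Real.exp 1 * ‖heatMacdonald 0 z‖ +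
            Real.Gamma (1 / 2) * r ^ (-(1 / 2) : ℝ) + (Real.exp 1 + Real.Gamma (1 / 2) +
            Real.exp 1 * r ^ (-(1 / 2) : ℝ) + Real.Gamma (1 / 2) * ‖heatMacdonald 0 z‖ +
            (Real.exp 1 + Real.Gamma (1 / 2)) * (r ^ (-(1 / 2) : ℝ) * ‖heatMacdonald 0 z‖)) by ring]
        refine le_add_of_nonneg_right ?_
        positivity
    · exact key _ (by positivity) fun z hz => norm_heatMacdonald_le_of_re_eq_zero hzero h0 hz
  · exact key _ (Real.Gamma_pos_of_pos hpos).le fun z hz => norm_heatMacdonald_le hpos hz.le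

end

/-! ### Transforms with completely monotone kernels -/

/-- The integral transform `∫₀^∞ k(w u²) h(u) du` with kernel `k`. In the variables `w = x⁻²` and
`w = y²` the Widder and Macdonald transforms take this form. -/
noncomputable def quadTransform (k h : ℝ → ℂ) (w : ℝ) : ℂ :=
  ∫ u in Ioi (0 : ℝ), k (w * u ^ 2) * h u

theorem stronglyMeasurable_quadTransform {k h : ℝ → ℂ} (hk : StronglyMeasurable k)
    (hh : AEStronglyMeasurable h (volume.restrict (Ioi 0))) :
    StronglyMeasurable (quadTransform k h) := by
  have e : quadTransform k h = quadTransform k (hh.mk h) := by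
    funext w
    refine integral_congr_ae ?_
    filter_upwards [hh.ae_eq_mk] with x hx
    rw [hx]
  rw [e]
  refine StronglyMeasurable.integral_prod_right
    (f := fun (w u : ℝ) => k (w * u ^ 2) * hh.mk h u) ?_
  exact (hk.comp_measurable (measurable_fst.mul (measurable_snd.pow_const 2))).mul
    (hh.stronglyMeasurable_mk.comp_measurable measurable_snd)

theorem ofReal_sq_cpow {u : ℝ} (hu : 0 < u) (a : ℂ) :
    ((u ^ 2 : ℝ) : ℂ) ^ a = (u : ℂ) ^ (2 * a) := by
  rw [sq, Complex.ofReal_mul, Complex.mul_cpow_ofReal_nonneg hu.le hu.le,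
    ← Complex.cpow_add _ _ (by exact_mod_cast hu.ne'), two_mul]

theorem ofReal_inv_cpow {x : ℝ} (hx : 0 < x) (a : ℂ) :
    ((x⁻¹ : ℝ) : ℂ) ^ a = (x : ℂ) ^ (-a) := by
  rw [Complex.cpow_neg, Complex.ofReal_inv, Complex.inv_cpow]
  rw [Complex.arg_ofReal_of_nonneg hx.le]
  exact Real.pi_pos.ne

/-- The moment of the transform with the completely monotone kernel
`k(z) = ∫ n(τ) e^{-z r(τ)} dτ`. -/
theorem integral_cpow_neg_mul_quadTransform {k n h : ℝ → ℂ} {r : ℝ → ℝ}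
    (hn : AEStronglyMeasurable n (volume.restrict (Ioi 0)))
    (hh : AEStronglyMeasurable h (volume.restrict (Ioi 0)))
    (hr : Measurable r) (hr0 : ∀ τ, 0 < τ → 0 < r τ)
    (hk : ∀ z, 0 < z → k z = ∫ τ in Ioi (0 : ℝ), n τ * (Real.exp (-(z * r τ)) : ℂ))
    {b : ℂ} (hb0 : 0 < b.re) (hb : ∀ n : ℕ, 1 - b ≠ -(n : ℂ))
    (hnb : IntegrableOn (fun τ => n τ * (r τ : ℂ) ^ (b - 1)) (Ioi 0))
    (hhb : IntegrableOn (fun u : ℝ => (u : ℂ) ^ (2 * b - 2) * h u) (Ioi 0))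
    (h1 : b.re < 1 ∨ IntegrableOn n (Ioi 0) ∧ IntegrableOn h (Ioi 0))
    (hI : IntegrableOn (fun w : ℝ => (w : ℂ) ^ (-b) * quadTransform k h w) (Ioi 0)) :
    ∫ w in Ioi (0 : ℝ), (w : ℂ) ^ (-b) * quadTransform k h w =
      Complex.Gamma (1 - b) * (∫ τ in Ioi (0 : ℝ), n τ * (r τ : ℂ) ^ (b - 1)) *
        ∫ u in Ioi (0 : ℝ), (u : ℂ) ^ (2 * b - 2) * h u := by
  set m := (volume.restrict (Ioi (0 : ℝ))).prod (volume.restrict (Ioi (0 : ℝ))) with hm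
  set ρ : ℝ × ℝ → ℝ := fun p => r p.2 * p.1 ^ 2 with hρ
  set f : ℝ × ℝ → ℂ := fun p => h p.1 * n p.2 with hf
  have hfm : AEStronglyMeasurable f m := hh.comp_fst.mul hn.comp_snd
  have hρm : Measurable ρ := (hr.comp measurable_snd).mul (measurable_fst.pow_const 2)
  have hmem : ∀ᵐ p ∂m, 0 < p.1 ∧ 0 < p.2 := by
    rw [hm, Measure.prod_restrict]
    filter_upwards [ae_restrict_mem (measurableSet_Ioi.prod measurableSet_Ioi)] with p hp
    exact hp
  have hpos : ∀ᵐ p ∂m, 0 < ρ p := by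
    filter_upwards [hmem] with p hp
    exact mul_pos (hr0 _ hp.2) (pow_pos hp.1 2)
  have hprod : (fun p : ℝ × ℝ => ((p.1 : ℂ) ^ (2 * b - 2) * h p.1) *
      (n p.2 * (r p.2 : ℂ) ^ (b - 1))) =ᵐ[m] fun p => f p * (ρ p : ℂ) ^ (b - 1) := by
    filter_upwards [hmem] with p hp
    simp only [hf, hρ]
    rw [Complex.ofReal_mul, Complex.mul_cpow_ofReal_nonneg (hr0 _ hp.2).le (by positivity),
      ofReal_sq_cpow hp.1, show 2 * (b - 1) = 2 * b - 2 by ring]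
    ring
  have hfb : Integrable (fun p => f p * (ρ p : ℂ) ^ (b - 1)) m :=
    (Integrable.mul_prod hhb hnb).congr hprod
  have hf1 : b.re < 1 ∨ Integrable f m := h1.imp_right fun h => Integrable.mul_prod h.2 h.1
  have hT : ∀ w ∈ Ioi (0 : ℝ), (w : ℂ) ^ (-b) * quadTransform k h w =
      (w : ℂ) ^ (-b) * expSuperposition m ρ f w := by
    intro w hw
    have hint := integrable_mul_exp_neg_of_div_one_add hfm hρm hpos hw
      (integrable_div_one_add_mul hfm hρm hpos hfb hb0.le hf1 hw)
    rw [expSuperposition, integral_prod _ hint, quadTransform]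
    congr 1
    refine setIntegral_congr_fun measurableSet_Ioi fun u hu => ?_
    have hz : 0 < w * u ^ 2 := mul_pos hw (pow_pos hu 2)
    simp only [hf, hρ]
    rw [hk _ hz, ← integral_mul_const]
    refine integral_congr_ae (Filter.Eventually.of_forall fun τ => ?_)
    simp only
    rw [show w * u ^ 2 * r τ = w * (r τ * u ^ 2) by ring]
    ring
  rw [setIntegral_congr_fun measurableSet_Ioi hT,
    integral_cpow_neg_mul_expSuperposition hfm hρm hpos hb0 hb hfb hf1
      (hI.congr_fun hT measurableSet_Ioi), ← integral_congr_ae hprod,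
    integral_prod_mul (fun u : ℝ => (u : ℂ) ^ (2 * b - 2) * h u)
      (fun τ => n τ * (r τ : ℂ) ^ (b - 1))]
  ring

/-! ### Averages of the Macdonald kernel -/

/-- The weight `(ν + 1 - v) e^{-v}`. Its factor `ν + 1 - b` in the `b`-th moment cancels the
first pole of `Γ(ν + 1 - b)`. -/
noncomputable def laguerreWeight (ν : ℂ) (v : ℝ) : ℂ := (ν + 1 - v) * (Real.exp (-v) : ℂ)

theorem heatMacdonald_eq_expSuperposition (ν : ℂ) (z : ℝ) :
    heatMacdonald ν z = expSuperposition (volume.restrict (Ioi 0)) (fun τ => (4 * τ)⁻¹)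
      (fun τ => (τ : ℂ) ^ (ν - 1) * (Real.exp (-τ) : ℂ)) z := by
  refine integral_congr_ae (Filter.Eventually.of_forall fun τ => ?_)
  simp only
  rw [neg_add, Real.exp_add, div_eq_mul_inv]
  push_cast
  ring

theorem integrableOn_cpow_mul_exp_div {ν : ℂ} (hν : -1 < ν.re) {z : ℝ} (hz : 0 < z) :
    IntegrableOn (fun τ : ℝ => (τ : ℂ) ^ (ν - 1) * (Real.exp (-τ) : ℂ) /
      (1 + z * (4 * τ)⁻¹ : ℝ)) (Ioi 0) := by
  have h := (integrableOn_cpow_mul_exp_neg_mul (a := ν + 1) (by simp; linarith)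
    one_pos).norm.const_mul (4 / z)
  refine h.mono' ?_ ?_
  · refine (Measurable.aestronglyMeasurable ?_).div₀ (Measurable.aestronglyMeasurable ?_)
    · exact (measurable_ofReal_cpow _).mul
        (Complex.measurable_ofReal.comp (Real.measurable_exp.comp measurable_id.neg))
    · exact Complex.measurable_ofReal.comp
        (((measurable_id.const_mul 4).inv.const_mul z).const_add 1)
  · filter_upwards [ae_restrict_mem measurableSet_Ioi] with τ hτ
    have hτ' : (0 : ℝ) < τ := hτ
    have hy : 0 < z * (4 * τ)⁻¹ := by positivity
    rw [norm_div, norm_cpow_mul_exp hτ', norm_cpow_mul_exp hτ', Complex.norm_real,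
      Real.norm_of_nonneg (by positivity), add_sub_cancel_right, Complex.sub_re, Complex.one_re,
      Real.rpow_sub_one hτ'.ne', one_mul]
    calc τ ^ ν.re / τ * Real.exp (-τ) / (1 + z * (4 * τ)⁻¹)
        ≤ τ ^ ν.re / τ * Real.exp (-τ) / (z * (4 * τ)⁻¹) := by gcongr; linarith
      _ = 4 / z * (τ ^ ν.re * Real.exp (-τ)) := by field_simp

/-- The averages of the Macdonald kernel are superpositions of the kernel `1 / (1 + z / (4τ))`. The
weight is chosen so that an integration by parts replaces `τ ^ (ν - 1)`, which need not be
integrable at `0`, by `τ ^ ν`. -/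
theorem integral_laguerreWeight_mul_heatMacdonald {ν : ℂ} (hν : -1 < ν.re) {z : ℝ} (hz : 0 < z) :
    ∫ v in Ioi (0 : ℝ), laguerreWeight ν v * heatMacdonald ν (v * z) =
      ∫ τ in Ioi (0 : ℝ), (τ : ℂ) ^ ν * (Real.exp (-τ) : ℂ) / (1 + z * (4 * τ)⁻¹ : ℝ) := by
  set c : ℝ := z / 4 with hc
  have hc0 : 0 < c := by positivity
  set f : ℝ → ℂ := fun τ => (τ : ℂ) ^ (ν - 1) * (Real.exp (-τ) : ℂ) with hf
  have hfm : AEStronglyMeasurable f (volume.restrict (Ioi 0)) :=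
    ((measurable_ofReal_cpow _).mul (Complex.measurable_ofReal.comp
      (Real.measurable_exp.comp measurable_id.neg))).aestronglyMeasurable
  have hρ : Measurable fun τ : ℝ => (4 * τ)⁻¹ := (measurable_id.const_mul 4).inv
  have hpos : ∀ᵐ τ ∂(volume.restrict (Ioi (0 : ℝ))), 0 < (4 * τ)⁻¹ := by
    filter_upwards [ae_restrict_mem measurableSet_Ioi] with τ hτ
    have hτ' : (0 : ℝ) < τ := hτ
    positivity
  have hdiv := integrableOn_cpow_mul_exp_div hν hz
  obtain ⟨i0, j0, k0⟩ := integral_pow_mul_expSuperposition hfm hρ hpos hz hdiv 0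
  obtain ⟨i1, j1, k1⟩ := integral_pow_mul_expSuperposition hfm hρ hpos hz hdiv 1
  have e : ∀ v : ℝ, laguerreWeight ν v * heatMacdonald ν (v * z) =
      (ν + 1) * ((v : ℂ) ^ 0 * (Real.exp (-v) : ℂ) * expSuperposition (volume.restrict (Ioi 0))
        (fun τ => (4 * τ)⁻¹) f (v * z)) - (v : ℂ) ^ 1 * (Real.exp (-v) : ℂ) *
        expSuperposition (volume.restrict (Ioi 0)) (fun τ => (4 * τ)⁻¹) f (v * z) := by
    intro v
    rw [heatMacdonald_eq_expSuperposition, laguerreWeight]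
    ring
  simp only [e]
  rw [integral_sub (j0.const_mul _) j1, integral_const_mul, k0, k1, Nat.factorial_zero,
    Nat.factorial_one, Nat.cast_one, one_mul, one_mul, ← integral_const_mul,
    ← integral_sub (i0.const_mul _) i1]
  -- integration by parts with the primitive `τ ^ (ν + 1) / (τ + c)`
  set E : ℝ → ℂ := fun τ => (Real.exp (-τ) : ℂ) with hE
  set G : ℝ → ℂ := fun τ => (τ : ℂ) ^ (ν + 1) / (τ + c : ℂ) with hG
  set G' : ℝ → ℂ := fun τ => ((ν + 1) * (τ : ℂ) ^ ν * (τ + c : ℂ) - (τ : ℂ) ^ (ν + 1)) /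
    (τ + c : ℂ) ^ 2 with hG'
  have hne : ∀ τ ∈ Ioi (0 : ℝ), (τ + c : ℂ) ≠ 0 := by
    intro τ hτ
    have : (0 : ℝ) < τ + c := add_pos hτ hc0
    exact_mod_cast this.ne'
  have hν1 : ν + 1 ≠ 0 := by
    intro h
    have := congrArg Complex.re h
    simp at this
    linarith
  have hdE : ∀ τ ∈ Ioi (0 : ℝ), HasDerivAt E (-E τ) τ := by
    intro τ _
    have := ((hasDerivAt_id τ).neg.exp).ofReal_comp
    refine this.congr_deriv ?_
    simp [hE]
  have hdG : ∀ τ ∈ Ioi (0 : ℝ), HasDerivAt G (G' τ) τ := by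
    intro τ hτ
    have d1 := hasDerivAt_ofReal_cpow_const (ne_of_gt hτ) hν1
    have d2 : HasDerivAt (fun τ : ℝ => (τ + c : ℂ)) 1 τ :=
      ((hasDerivAt_id τ).ofReal_comp).add_const _
    refine (d1.div d2 (hne τ hτ)).congr_deriv ?_
    simp only [hG']
    rw [add_sub_cancel_right, mul_one]
  have e1 : ∀ τ ∈ Ioi (0 : ℝ), (ν + 1) * (f τ / ((1 + z * (4 * τ)⁻¹ : ℝ) : ℂ) ^ (0 + 1)) -
      f τ / ((1 + z * (4 * τ)⁻¹ : ℝ) : ℂ) ^ (1 + 1) = (E * G') τ := by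
    intro τ hτ
    have hτ0 : (τ : ℂ) ≠ 0 := by exact_mod_cast (ne_of_gt hτ)
    have h1 : ((1 + z * (4 * τ)⁻¹ : ℝ) : ℂ) = (τ + c : ℂ) / τ := by
      rw [hc]; push_cast; field_simp
    have := hne τ hτ
    simp only [hf, hE, hG', Pi.mul_apply]
    rw [h1, Complex.cpow_sub _ _ hτ0, Complex.cpow_add _ _ hτ0, Complex.cpow_one, zero_add,
      pow_one, one_add_one_eq_two, div_pow]
    field_simp
  have e2 : ∀ τ ∈ Ioi (0 : ℝ), (τ : ℂ) ^ ν * (Real.exp (-τ) : ℂ) / (1 + z * (4 * τ)⁻¹ : ℝ) =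
      E τ * G τ := by
    intro τ hτ
    have hτ0 : (τ : ℂ) ≠ 0 := by exact_mod_cast (ne_of_gt hτ)
    have h1 : ((1 + z * (4 * τ)⁻¹ : ℝ) : ℂ) = (τ + c : ℂ) / τ := by
      rw [hc]; push_cast; field_simp
    have := hne τ hτ
    simp only [hE, hG]
    rw [h1, Complex.cpow_add _ _ hτ0, Complex.cpow_one]
    field_simp
  have hi2 : IntegrableOn ((fun τ => -E τ) * G) (Ioi 0) := by
    have h := integrableOn_cpow_mul_exp_div (ν := ν + 1) (by simp; linarith) hz
    refine IntegrableOn.congr_fun h.neg (fun τ hτ => ?_) measurableSet_Ioi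
    simp only [Pi.neg_apply, Pi.mul_apply, add_sub_cancel_right]
    rw [e2 τ hτ]
    ring
  have hnorm : ∀ τ ∈ Ioi (0 : ℝ), ‖(E * G) τ‖ ≤ 1 / c * (τ ^ (ν.re + 1) * Real.exp (-1 * τ)) := by
    intro τ hτ
    have hτ' : (0 : ℝ) < τ := hτ
    have h1 := norm_cpow_mul_exp hτ (ν + 1) (-τ)
    have h2 : (τ + c : ℂ) = ((τ + c : ℝ) : ℂ) := by push_cast; rfl
    simp only [hE, hG, Pi.mul_apply]
    rw [← mul_div_assoc, mul_comm, norm_div, h1, h2, Complex.norm_real,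
      Real.norm_of_nonneg (by positivity), Complex.add_re, Complex.one_re, neg_one_mul,
      one_div_mul_eq_div]
    gcongr
    linarith
  have hlim0 : Filter.Tendsto (E * G) (nhdsWithin 0 (Ioi 0)) (nhds 0) := by
    refine squeeze_zero_norm' (eventually_nhdsWithin_of_forall hnorm) ?_
    have : ContinuousAt (fun τ : ℝ => 1 / c * (τ ^ (ν.re + 1) * Real.exp (-1 * τ))) 0 :=
      ((Real.continuousAt_rpow_const 0 _ (Or.inr (by linarith))).mul (by fun_prop)).const_mul _
    have h0 := this.tendsto
    simp only [Real.zero_rpow (show ν.re + 1 ≠ 0 by linarith), zero_mul, mul_zero] at h0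
    exact h0.mono_left nhdsWithin_le_nhds
  have hliminf : Filter.Tendsto (E * G) Filter.atTop (nhds 0) := by
    refine squeeze_zero_norm' ((Filter.eventually_gt_atTop 0).mono hnorm) ?_
    have := (tendsto_rpow_mul_exp_neg_mul_atTop_nhds_zero (ν.re + 1) 1 one_pos).const_mul (1 / c)
    simpa using this
  have h := integral_Ioi_mul_deriv_eq_deriv_mul hdE hdG
    (IntegrableOn.congr_fun ((i0.const_mul (ν + 1)).sub i1) e1 measurableSet_Ioi)
    hi2 hlim0 hliminf
  rw [setIntegral_congr_fun measurableSet_Ioi e1, setIntegral_congr_fun measurableSet_Ioi e2]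
  refine h.trans ?_
  simp [integral_neg]

/-! ### Comparison of the two transforms -/

theorem laguerreWeight_moment (ν : ℂ) {a : ℂ} (ha : 0 < a.re) :
    IntegrableOn (fun v : ℝ => laguerreWeight ν v * (v : ℂ) ^ (a - 1)) (Ioi 0) ∧
    ∫ v in Ioi (0 : ℝ), laguerreWeight ν v * (v : ℂ) ^ (a - 1) =
      (ν + 1 - a) * Complex.Gamma a := by
  have ha0 : a ≠ 0 := by rintro rfl; simp at ha
  have ha1 : 0 < (a + 1).re := by simp; linarith
  have e : ∀ v ∈ Ioi (0 : ℝ), (ν + 1) * ((v : ℂ) ^ (a - 1) * (Real.exp (-(1 * v)) : ℂ)) -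
      (v : ℂ) ^ (a + 1 - 1) * (Real.exp (-(1 * v)) : ℂ) =
      laguerreWeight ν v * (v : ℂ) ^ (a - 1) := by
    intro v hv
    have hv0 : (v : ℂ) ≠ 0 := by exact_mod_cast (ne_of_gt hv)
    rw [show a + 1 - 1 = a - 1 + 1 by ring, Complex.cpow_add _ _ hv0, Complex.cpow_one, one_mul,
      laguerreWeight]
    ring
  have i1 := (integrableOn_cpow_mul_exp_neg_mul ha one_pos).const_mul (ν + 1)
  have i2 := integrableOn_cpow_mul_exp_neg_mul ha1 one_pos
  refine ⟨IntegrableOn.congr_fun (i1.sub i2) e measurableSet_Ioi, ?_⟩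
  rw [← setIntegral_congr_fun measurableSet_Ioi e, integral_sub i1 i2, integral_const_mul,
    integral_cpow_mul_exp_neg_mul ha one_pos, integral_cpow_mul_exp_neg_mul ha1 one_pos,
    Complex.Gamma_add_one _ ha0]
  simp
  ring

theorem continuous_laguerreWeight (ν : ℂ) : Continuous (laguerreWeight ν) := by
  unfold laguerreWeight
  fun_prop

theorem norm_laguerreWeight_le (ν : ℂ) {v : ℝ} (hv : 0 < v) :
    ‖laguerreWeight ν v‖ ≤ ‖ν + 1‖ + 1 := by
  rw [laguerreWeight, norm_mul, Complex.norm_real, Real.norm_of_nonneg (Real.exp_pos _).le]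
  have h1 : ‖ν + 1 - v‖ ≤ ‖ν + 1‖ + v := by
    refine (norm_sub_le _ _).trans ?_
    rw [Complex.norm_real, Real.norm_of_nonneg hv.le]
  have h2 : Real.exp (-v) ≤ 1 := Real.exp_le_one_iff.mpr (by linarith)
  have h3 : v * Real.exp (-v) ≤ 1 := by
    rw [Real.exp_neg, ← div_eq_mul_inv, div_le_one (Real.exp_pos v)]
    linarith [Real.add_one_le_exp v]
  calc ‖ν + 1 - v‖ * Real.exp (-v) ≤ (‖ν + 1‖ + v) * Real.exp (-v) := by gcongr
    _ = ‖ν + 1‖ * Real.exp (-v) + v * Real.exp (-v) := by ring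
    _ ≤ ‖ν + 1‖ * 1 + 1 := by gcongr
    _ = _ := by ring

/-- Absolute convergence of the double integral behind the comparison of the two transforms. For
small `u` the dilation bound reduces it to one instance `w = w₀` of the second transform, for
large `u` the integrability of `heatMacdonald ν` gives the decay `u⁻²`, which the first transform
controls. -/
theorem integrable_laguerreWeight_mul_heatMacdonald {ν : ℂ} (hν : -1 < ν.re) {h : ℝ → ℂ}
    (hm : AEStronglyMeasurable h (volume.restrict (Ioi 0)))
    (hW : IntegrableOn (fun u : ℝ => h u / (1 + u ^ 2 : ℝ)) (Ioi 0)) {w₀ : ℝ} (hw₀ : 0 < w₀)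
    (hK : IntegrableOn (fun u : ℝ => heatMacdonald ν (w₀ * u ^ 2) * h u) (Ioi 0))
    {w : ℝ} (hw : 0 < w) :
    Integrable (fun p : ℝ × ℝ => h p.1 *
      (laguerreWeight ν p.2 * heatMacdonald ν (p.2 * (w * p.1 ^ 2))))
      ((volume.restrict (Ioi 0)).prod (volume.restrict (Ioi 0))) := by
  have hmeas : AEStronglyMeasurable (fun p : ℝ × ℝ => h p.1 *
      (laguerreWeight ν p.2 * heatMacdonald ν (p.2 * (w * p.1 ^ 2))))
      ((volume.restrict (Ioi (0 : ℝ))).prod (volume.restrict (Ioi (0 : ℝ)))) := by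
    refine hm.comp_fst.mul (StronglyMeasurable.aestronglyMeasurable ?_)
    refine ((continuous_laguerreWeight ν).stronglyMeasurable.comp_measurable measurable_snd).mul ?_
    exact (stronglyMeasurable_heatMacdonald ν).comp_measurable
      (measurable_snd.mul ((measurable_fst.pow_const 2).const_mul w))
  obtain ⟨C, p, hC, hp0, hp1, hdil⟩ := exists_norm_heatMacdonald_dilate_le hν
  set K : ℝ := ‖ν + 1‖ + 1 with hKdef
  have hK0 : 0 ≤ K := by positivity
  set N : ℝ := ∫ z in Ioi (0 : ℝ), ‖heatMacdonald ν z‖ with hN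
  have hN0 : 0 ≤ N := integral_nonneg fun z => norm_nonneg _
  have hbk := integrableOn_heatMacdonald_Ioi hν
  have hbks : ∀ s : ℝ, 0 < s → IntegrableOn (fun v => heatMacdonald ν (v * s)) (Ioi 0) := by
    intro s hs
    exact (integrableOn_Ioi_comp_mul_right_iff (heatMacdonald ν) 0 hs).mpr (by simpa using hbk)
  have hχm (s : ℝ) : AEStronglyMeasurable
      (fun v => laguerreWeight ν v * heatMacdonald ν (v * s)) (volume.restrict (Ioi 0)) :=
    ((continuous_laguerreWeight ν).stronglyMeasurable.mul
      ((stronglyMeasurable_heatMacdonald ν).comp_measurable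
        (measurable_id.mul_const s))).aestronglyMeasurable
  have hleK (s : ℝ) : ∀ᵐ v ∂(volume.restrict (Ioi (0 : ℝ))),
      ‖laguerreWeight ν v * heatMacdonald ν (v * s)‖ ≤ K * ‖heatMacdonald ν (v * s)‖ := by
    filter_upwards [ae_restrict_mem measurableSet_Ioi] with v hv
    rw [norm_mul]
    exact mul_le_mul_of_nonneg_right (norm_laguerreWeight_le ν hv) (norm_nonneg _)
  have hint : ∀ s : ℝ, 0 < s →
      IntegrableOn (fun v => laguerreWeight ν v * heatMacdonald ν (v * s)) (Ioi 0) :=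
    fun s hs => ((hbks s hs).norm.const_mul K).mono' (hχm s) (hleK s)
  -- the bound used for large `u`
  have boundA : ∀ s : ℝ, 0 < s →
      ∫ v in Ioi (0 : ℝ), ‖laguerreWeight ν v * heatMacdonald ν (v * s)‖ ≤ K * N / s := by
    intro s hs
    have h1 := integral_mono_ae (hint s hs).norm ((hbks s hs).norm.const_mul K) (hleK s)
    refine h1.trans (le_of_eq ?_)
    rw [integral_const_mul, integral_comp_mul_right_Ioi (fun z => ‖heatMacdonald ν z‖) 0 hs,
      zero_mul, smul_eq_mul]
    ring
  -- the bound used for small `u`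
  set M : ℝ := ∫ v in Ioi (0 : ℝ), ‖laguerreWeight ν v‖ * (C * (1 + (v * (w / w₀)) ^ (-p)))
    with hM
  have hMint : IntegrableOn
      (fun v : ℝ => ‖laguerreWeight ν v‖ * (C * (1 + (v * (w / w₀)) ^ (-p)))) (Ioi 0) := by
    have h1 := (laguerreWeight_moment ν (a := 1) (by simp)).1.norm
    have h2 := (laguerreWeight_moment ν (a := ((1 - p : ℝ) : ℂ)) (by simpa using hp1)).1.norm
    refine IntegrableOn.congr_fun (((h1.add (h2.const_mul ((w / w₀) ^ (-p)))).const_mul C))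
      (fun v hv => ?_) measurableSet_Ioi
    have hv' : (0 : ℝ) < v := hv
    simp only [Pi.add_apply, norm_mul]
    rw [Complex.norm_cpow_eq_rpow_re_of_pos hv', Complex.norm_cpow_eq_rpow_re_of_pos hv',
      Real.mul_rpow hv'.le (by positivity)]
    simp
    ring
  have hM0 : 0 ≤ M := by
    refine setIntegral_nonneg measurableSet_Ioi fun v hv => ?_
    have hv' : (0 : ℝ) < v := hv
    positivity
  have boundB : ∀ u : ℝ, 0 < u →
      ∫ v in Ioi (0 : ℝ), ‖laguerreWeight ν v * heatMacdonald ν (v * (w * u ^ 2))‖ ≤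
        M * (1 + ‖heatMacdonald ν (w₀ * u ^ 2)‖) := by
    intro u hu
    have hs : 0 < w * u ^ 2 := by positivity
    rw [hM, ← integral_mul_const]
    refine setIntegral_mono_on (hint _ hs).norm (hMint.mul_const _) measurableSet_Ioi
      fun v hv => ?_
    have hv' : (0 : ℝ) < v := hv
    have := hdil (v * (w / w₀)) (w₀ * u ^ 2) (by positivity) (by positivity)
    rw [show v * (w / w₀) * (w₀ * u ^ 2) = v * (w * u ^ 2) by field_simp] at this
    rw [norm_mul, mul_assoc]
    gcongr
  rw [integrable_prod_iff hmeas]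
  constructor
  · filter_upwards [ae_restrict_mem measurableSet_Ioi] with u hu
    have hu' : (0 : ℝ) < u := hu
    exact (hint (w * u ^ 2) (by positivity)).const_mul (h u)
  · refine ((hK.norm.const_mul M).add (hW.norm.const_mul (2 * M + 2 * (K * N / w)))).mono'
      hmeas.norm.integral_prod_right' ?_
    filter_upwards [ae_restrict_mem measurableSet_Ioi] with u hu
    have hu' : (0 : ℝ) < u := hu
    have hA := boundA (w * u ^ 2) (by positivity)
    have hB := boundB u hu'
    rw [Real.norm_of_nonneg (integral_nonneg fun v => norm_nonneg _)]
    simp only [norm_mul (h u), Pi.add_apply]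
    rw [integral_const_mul, norm_div, norm_mul, Complex.norm_real,
      Real.norm_of_nonneg (by positivity)]
    have hhn := norm_nonneg (h u)
    have hbn := norm_nonneg (heatMacdonald ν (w₀ * u ^ 2))
    have hKN : 0 ≤ K * N / w := by positivity
    have hq : 0 ≤ ‖h u‖ / (1 + u ^ 2) := by positivity
    rcases le_total u 1 with h1 | h1
    · have h2 : ‖h u‖ ≤ 2 * (‖h u‖ / (1 + u ^ 2)) := by
        have h3 : u ^ 2 ≤ 1 := pow_le_one₀ hu'.le h1
        rw [← mul_div_assoc, le_div_iff₀ (by positivity)]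
        nlinarith
      calc ‖h u‖ * _ ≤ ‖h u‖ * (M * (1 + ‖heatMacdonald ν (w₀ * u ^ 2)‖)) := by gcongr
        _ = M * (‖heatMacdonald ν (w₀ * u ^ 2)‖ * ‖h u‖) + M * ‖h u‖ := by ring
        _ ≤ M * (‖heatMacdonald ν (w₀ * u ^ 2)‖ * ‖h u‖) +
            M * (2 * (‖h u‖ / (1 + u ^ 2))) := by gcongr
        _ ≤ _ := by nlinarith
    · have h2 : 1 / u ^ 2 ≤ 2 / (1 + u ^ 2) := by
        rw [div_le_div_iff₀ (by positivity) (by positivity)]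
        nlinarith
      calc ‖h u‖ * _ ≤ ‖h u‖ * (K * N / (w * u ^ 2)) := by gcongr
        _ = ‖h u‖ * (K * N / w) * (1 / u ^ 2) := by field_simp
        _ ≤ ‖h u‖ * (K * N / w) * (2 / (1 + u ^ 2)) := by gcongr
        _ = 2 * (K * N / w) * (‖h u‖ / (1 + u ^ 2)) := by ring
        _ ≤ _ := by
          have : 0 ≤ M * (‖heatMacdonald ν (w₀ * u ^ 2)‖ * ‖h u‖) := by positivity
          nlinarith

/-- The kernel `1 / (1 + z)` of the Widder transform in the variable `z = u² / x²`. -/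
noncomputable def stieltjesKernel (z : ℝ) : ℂ := ((1 + z : ℝ) : ℂ)⁻¹

theorem stronglyMeasurable_stieltjesKernel : StronglyMeasurable stieltjesKernel :=
  (Complex.measurable_ofReal.comp (measurable_id.const_add 1)).inv.stronglyMeasurable

/-- Averaging the Macdonald transform against `(ν + 1 - v) e^{-v}` is the same as averaging the
Widder transform against `τ ^ ν e^{-τ}`. -/
theorem integral_laguerreWeight_mul_quadTransform {ν : ℂ} (hν : -1 < ν.re) {h : ℝ → ℂ}
    (hm : AEStronglyMeasurable h (volume.restrict (Ioi 0)))
    (hW : IntegrableOn (fun u : ℝ => h u / (1 + u ^ 2 : ℝ)) (Ioi 0)) {w₀ : ℝ} (hw₀ : 0 < w₀)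
    (hK : IntegrableOn (fun u : ℝ => heatMacdonald ν (w₀ * u ^ 2) * h u) (Ioi 0))
    {w : ℝ} (hw : 0 < w) :
    ∫ v in Ioi (0 : ℝ), laguerreWeight ν v * quadTransform (heatMacdonald ν) h (v * w) =
      ∫ τ in Ioi (0 : ℝ), (τ : ℂ) ^ ν * (Real.exp (-τ) : ℂ) *
        quadTransform stieltjesKernel h ((4 * τ)⁻¹ * w) := by
  have hJ := integrable_laguerreWeight_mul_heatMacdonald hν hm hW hw₀ hK hw
  have e1 : ∀ v : ℝ, laguerreWeight ν v * quadTransform (heatMacdonald ν) h (v * w) =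
      ∫ u in Ioi (0 : ℝ), h u * (laguerreWeight ν v * heatMacdonald ν (v * (w * u ^ 2))) := by
    intro v
    rw [quadTransform, ← integral_const_mul]
    refine integral_congr_ae (Filter.Eventually.of_forall fun u => ?_)
    simp only [mul_assoc v w]
    ring
  have e2 : ∀ τ : ℝ, (τ : ℂ) ^ ν * (Real.exp (-τ) : ℂ) *
      quadTransform stieltjesKernel h ((4 * τ)⁻¹ * w) = ∫ u in Ioi (0 : ℝ),
        h u * ((τ : ℂ) ^ ν * (Real.exp (-τ) : ℂ) / (1 + w * u ^ 2 * (4 * τ)⁻¹ : ℝ)) := by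
    intro τ
    rw [quadTransform, ← integral_const_mul]
    refine integral_congr_ae (Filter.Eventually.of_forall fun u => ?_)
    simp only [stieltjesKernel]
    rw [show (4 * τ)⁻¹ * w * u ^ 2 = w * u ^ 2 * (4 * τ)⁻¹ by ring]
    ring
  have hmeas : AEStronglyMeasurable (fun p : ℝ × ℝ => h p.1 * ((p.2 : ℂ) ^ ν *
      (Real.exp (-p.2) : ℂ) / (1 + w * p.1 ^ 2 * (4 * p.2)⁻¹ : ℝ)))
      ((volume.restrict (Ioi (0 : ℝ))).prod (volume.restrict (Ioi (0 : ℝ)))) := by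
    refine hm.comp_fst.mul (Measurable.aestronglyMeasurable ?_)
    refine Measurable.div (((measurable_ofReal_cpow _).comp measurable_snd).mul
      (Complex.measurable_ofReal.comp (Real.measurable_exp.comp measurable_snd.neg))) ?_
    exact Complex.measurable_ofReal.comp ((((measurable_fst.pow_const 2).const_mul w).mul
      (measurable_snd.const_mul 4).inv).const_add 1)
  have hint : Integrable (fun p : ℝ × ℝ => h p.1 * ((p.2 : ℂ) ^ ν *
      (Real.exp (-p.2) : ℂ) / (1 + w * p.1 ^ 2 * (4 * p.2)⁻¹ : ℝ)))
      ((volume.restrict (Ioi (0 : ℝ))).prod (volume.restrict (Ioi (0 : ℝ)))) := by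
    have g1 := (integrableOn_cpow_mul_exp_neg_mul (a := ν + 1) (by simp; linarith) one_pos).norm
    have g2 := (integrableOn_cpow_mul_exp_neg_mul (a := ν + 2) (by simp; linarith)
      one_pos).norm.const_mul (4 / w)
    refine (Integrable.mul_prod hW.norm (g1.add g2)).mono' hmeas ?_
    rw [Measure.prod_restrict]
    filter_upwards [ae_restrict_mem (measurableSet_Ioi.prod measurableSet_Ioi)] with p hp
    have hu : (0 : ℝ) < p.1 := hp.1
    have hτ : (0 : ℝ) < p.2 := hp.2
    have hy : 0 < w * p.1 ^ 2 * (4 * p.2)⁻¹ := by positivity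
    simp only [Pi.add_apply]
    rw [norm_mul, norm_div, norm_div, norm_cpow_mul_exp hτ, norm_cpow_mul_exp hτ,
      norm_cpow_mul_exp hτ, Complex.norm_real, Complex.norm_real,
      Real.norm_of_nonneg (by positivity), Real.norm_of_nonneg (by positivity),
      add_sub_cancel_right, show (ν + 2 - 1).re = ν.re + 1 by simp; ring,
      Real.rpow_add_one hτ.ne', one_mul]
    have hcomp : 1 / (1 + w * p.1 ^ 2 * (4 * p.2)⁻¹) ≤
        1 / (1 + p.1 ^ 2) * (1 + 4 / w * p.2) := by
      rw [one_div_mul_eq_div, div_le_div_iff₀ (by positivity) (by positivity)]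
      have : (1 + 4 / w * p.2) * (1 + w * p.1 ^ 2 * (4 * p.2)⁻¹) =
          1 + p.1 ^ 2 + (4 / w * p.2 + w * p.1 ^ 2 * (4 * p.2)⁻¹) := by
        field_simp; ring
      rw [this]
      have : 0 < 4 / w * p.2 := by positivity
      linarith
    calc ‖h p.1‖ * (p.2 ^ ν.re * Real.exp (-p.2) / (1 + w * p.1 ^ 2 * (4 * p.2)⁻¹))
        = ‖h p.1‖ * (p.2 ^ ν.re * Real.exp (-p.2)) * (1 / (1 + w * p.1 ^ 2 * (4 * p.2)⁻¹)) := by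
          ring
      _ ≤ ‖h p.1‖ * (p.2 ^ ν.re * Real.exp (-p.2)) *
          (1 / (1 + p.1 ^ 2) * (1 + 4 / w * p.2)) := by gcongr
      _ = _ := by ring
  simp only [e1, e2]
  rw [integral_integral_swap (f := fun (v u : ℝ) => h u * (laguerreWeight ν v *
      heatMacdonald ν (v * (w * u ^ 2)))) hJ.swap,
    integral_integral_swap (f := fun (τ u : ℝ) => h u * ((τ : ℂ) ^ ν * (Real.exp (-τ) : ℂ) /
      (1 + w * u ^ 2 * (4 * τ)⁻¹ : ℝ))) hint.swap]
  refine setIntegral_congr_fun measurableSet_Ioi fun u hu => ?_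
  have hu' : (0 : ℝ) < u := hu
  rw [integral_const_mul, integral_const_mul,
    integral_laguerreWeight_mul_heatMacdonald hν (by positivity)]

theorem integral_cpow_mul_exp_mul_inv_four_mul {a b : ℂ} (hab : 0 < (a + 1 - b).re) :
    IntegrableOn (fun τ : ℝ => (τ : ℂ) ^ (a - 1) * (Real.exp (-τ) : ℂ) *
      (((4 * τ)⁻¹ : ℝ) : ℂ) ^ (b - 1)) (Ioi 0) ∧
    ∫ τ in Ioi (0 : ℝ), (τ : ℂ) ^ (a - 1) * (Real.exp (-τ) : ℂ) *
      (((4 * τ)⁻¹ : ℝ) : ℂ) ^ (b - 1) = (2 : ℂ) ^ (2 - 2 * b) * Complex.Gamma (a + 1 - b) := by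
  have e : ∀ τ ∈ Ioi (0 : ℝ), (2 : ℂ) ^ (2 - 2 * b) *
      ((τ : ℂ) ^ (a + 1 - b - 1) * (Real.exp (-(1 * τ)) : ℂ)) =
      (τ : ℂ) ^ (a - 1) * (Real.exp (-τ) : ℂ) * (((4 * τ)⁻¹ : ℝ) : ℂ) ^ (b - 1) := by
    intro τ hτ
    have hτ' : (0 : ℝ) < τ := hτ
    have hτ0 : (τ : ℂ) ≠ 0 := by exact_mod_cast hτ'.ne'
    have h4 : ((4 : ℝ) : ℂ) ^ (1 - b) = (2 : ℂ) ^ (2 - 2 * b) := by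
      have := ofReal_sq_cpow (u := 2) two_pos (1 - b)
      rw [show (2 : ℝ) ^ 2 = 4 by norm_num] at this
      rw [this]
      push_cast
      ring_nf
    rw [ofReal_inv_cpow (by positivity), Complex.ofReal_mul, neg_sub,
      Complex.mul_cpow_ofReal_nonneg (by norm_num) hτ'.le, h4,
      show a + 1 - b - 1 = (a - 1) + (1 - b) by ring, Complex.cpow_add _ _ hτ0, one_mul]
    ring
  have i := (integrableOn_cpow_mul_exp_neg_mul hab one_pos).const_mul ((2 : ℂ) ^ (2 - 2 * b))
  refine ⟨IntegrableOn.congr_fun i e measurableSet_Ioi, ?_⟩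
  rw [← setIntegral_congr_fun measurableSet_Ioi e, integral_const_mul,
    integral_cpow_mul_exp_neg_mul hab one_pos]
  simp

/-- The comparison of the moments of the Widder and Macdonald transforms. Neither moment need be
an absolutely convergent double integral, so they are compared through averages of the two
transforms that coincide. -/
theorem Gamma_mul_integral_quadTransform_heatMacdonald {ν b : ℂ} (hν : -1 < ν.re)
    (hb0 : 0 < b.re) (hνb : 0 < (ν + 1 - b).re) {h : ℝ → ℂ}
    (hm : AEStronglyMeasurable h (volume.restrict (Ioi 0)))
    (hW : IntegrableOn (fun u : ℝ => h u / (1 + u ^ 2 : ℝ)) (Ioi 0)) {w₀ : ℝ} (hw₀ : 0 < w₀)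
    (hK : IntegrableOn (fun u : ℝ => heatMacdonald ν (w₀ * u ^ 2) * h u) (Ioi 0))
    (hI1 : IntegrableOn (fun w : ℝ => (w : ℂ) ^ (-b) * quadTransform stieltjesKernel h w) (Ioi 0))
    (hI2 : IntegrableOn
      (fun w : ℝ => (w : ℂ) ^ (-b) * quadTransform (heatMacdonald ν) h w) (Ioi 0)) :
    Complex.Gamma b * ∫ w in Ioi (0 : ℝ), (w : ℂ) ^ (-b) * quadTransform (heatMacdonald ν) h w =
      (2 : ℂ) ^ (2 - 2 * b) * Complex.Gamma (ν + 1 - b) *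
        ∫ w in Ioi (0 : ℝ), (w : ℂ) ^ (-b) * quadTransform stieltjesKernel h w := by
  obtain ⟨m1, m2⟩ := laguerreWeight_moment ν hb0
  obtain ⟨-, k2⟩ := integral_cpow_mul_integral_dilate (volume.restrict (Ioi (0 : ℝ)))
    (continuous_laguerreWeight ν).aestronglyMeasurable (s := fun v => v) measurable_id
    (ae_restrict_mem measurableSet_Ioi)
    (stronglyMeasurable_quadTransform (stronglyMeasurable_heatMacdonald ν) hm) b m1 hI2
  have hνb1 : 0 < (ν + 1 + 1 - b).re := by
    have : (ν + 1 + 1 - b).re = (ν + 1 - b).re + 1 := by simp; ring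
    linarith
  obtain ⟨n1, n2⟩ := integral_cpow_mul_exp_mul_inv_four_mul (a := ν + 1) hνb1
  simp only [add_sub_cancel_right] at n1 n2
  have hpos : ∀ᵐ τ ∂(volume.restrict (Ioi (0 : ℝ))), 0 < (4 * τ)⁻¹ := by
    filter_upwards [ae_restrict_mem measurableSet_Ioi] with τ hτ
    have hτ' : (0 : ℝ) < τ := hτ
    positivity
  obtain ⟨-, l2⟩ := integral_cpow_mul_integral_dilate (volume.restrict (Ioi (0 : ℝ)))
    (χ := fun τ => (τ : ℂ) ^ ν * (Real.exp (-τ) : ℂ)) (s := fun τ => (4 * τ)⁻¹)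
    ((measurable_ofReal_cpow _).mul (Complex.measurable_ofReal.comp
      (Real.measurable_exp.comp measurable_id.neg))).aestronglyMeasurable
    (measurable_id.const_mul 4).inv hpos
    (stronglyMeasurable_quadTransform stronglyMeasurable_stieltjesKernel hm) b n1 hI1
  have e : ∀ w ∈ Ioi (0 : ℝ), (w : ℂ) ^ (-b) *
      ∫ v in Ioi (0 : ℝ), laguerreWeight ν v * quadTransform (heatMacdonald ν) h (v * w) =
      (w : ℂ) ^ (-b) * ∫ τ in Ioi (0 : ℝ), (τ : ℂ) ^ ν * (Real.exp (-τ) : ℂ) *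
        quadTransform stieltjesKernel h ((4 * τ)⁻¹ * w) := fun w hw => by
    rw [integral_laguerreWeight_mul_quadTransform hν hm hW hw₀ hK hw]
  rw [setIntegral_congr_fun measurableSet_Ioi e, l2, n2, m2] at k2
  have hne : ν + 1 - b ≠ 0 := by
    intro h0
    rw [h0] at hνb
    simp at hνb
  rw [show ν + 1 + 1 - b = (ν + 1 - b) + 1 by ring, Complex.Gamma_add_one _ hne] at k2
  refine mul_left_cancel₀ hne ?_
  linear_combination -k2

/-! ### Reduction of the Widder and Macdonald moments -/

theorem exists_pos_of_ae_restrict_Ioi {p : ℝ → Prop}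
    (h : ∀ᵐ x ∂(volume.restrict (Ioi (0 : ℝ))), p x) : ∃ x, 0 < x ∧ p x := by
  have : (ae (volume.restrict (Ioi (0 : ℝ)))).NeBot := by
    rw [ae_neBot, Ne, Measure.restrict_eq_zero]
    simp
  exact ((ae_restrict_mem measurableSet_Ioi).and h).exists

/-- The moment of a function `W` on the half-line whose values are those of `T` after a power
substitution, `x = w ^ p`. -/
theorem integral_cpow_mul_of_rpow_substitution {W T : ℝ → ℂ} {a b c : ℂ} {p : ℝ} (hp : p ≠ 0)
    (h : ∀ w : ℝ, 0 < w → ((|p| * w ^ (p - 1) : ℝ) : ℂ) * (((w ^ p : ℝ) : ℂ) ^ a * W (w ^ p)) =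
      c * ((w : ℂ) ^ (-b) * T w)) (hc : c ≠ 0)
    (hI : IntegrableOn (fun x : ℝ => (x : ℂ) ^ a * W x) (Ioi 0)) :
    IntegrableOn (fun w : ℝ => (w : ℂ) ^ (-b) * T w) (Ioi 0) ∧
    ∫ x in Ioi (0 : ℝ), (x : ℂ) ^ a * W x = c * ∫ w in Ioi (0 : ℝ), (w : ℂ) ^ (-b) * T w := by
  have e : ∀ w ∈ Ioi (0 : ℝ), (|p| * w ^ (p - 1)) •
      (fun x : ℝ => (x : ℂ) ^ a * W x) (w ^ p) = c * ((w : ℂ) ^ (-b) * T w) := by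
    intro w hw
    rw [Complex.real_smul, ← h w hw]
  constructor
  · have h1 := ((integrableOn_Ioi_comp_rpow_iff _ hp).mpr hI).congr_fun e measurableSet_Ioi
    refine IntegrableOn.congr_fun (h1.const_mul c⁻¹) (fun w _ => ?_) measurableSet_Ioi
    rw [inv_mul_cancel_left₀ hc]
  · rw [← integral_comp_rpow_Ioi (fun x : ℝ => (x : ℂ) ^ a * W x) hp,
      setIntegral_congr_fun measurableSet_Ioi e, integral_const_mul]

theorem ofReal_rpow_cpow {w : ℝ} (hw : 0 < w) (p : ℝ) (a : ℂ) :
    ((w ^ p : ℝ) : ℂ) ^ a = (w : ℂ) ^ (p * a) := by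
  rw [Complex.cpow_def_of_ne_zero (by exact_mod_cast (Real.rpow_pos_of_pos hw p).ne'),
    Complex.cpow_def_of_ne_zero (by exact_mod_cast hw.ne'),
    ← Complex.ofReal_log (Real.rpow_pos_of_pos hw p).le, ← Complex.ofReal_log hw.le,
    Real.log_rpow hw]
  push_cast
  ring_nf

/-- The substitution `x = w ^ (-1/2)` in the Widder moment. -/
theorem WidderMomentExists.reduce {μ ν b : ℂ} {g h : ℝ → ℂ}
    (hb : b = μ / 2 + ν / 2 + 3 / 4) (hh : h = fun u : ℝ => (u : ℂ) ^ (1 / 2 - ν) * g u)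
    (H : WidderMomentExists (μ + ν + 1 / 2) (fun u : ℝ => (u : ℂ) ^ (-ν - 1 / 2) * g u)) :
    IntegrableOn (fun u : ℝ => h u / (1 + u ^ 2 : ℝ)) (Ioi 0) ∧
    IntegrableOn (fun w : ℝ => (w : ℂ) ^ (-b) * quadTransform stieltjesKernel h w) (Ioi 0) ∧
    ∫ x in Ioi (0 : ℝ), (x : ℂ) ^ (μ + ν + 1 / 2) *
        widderTransform (fun u : ℝ => (u : ℂ) ^ (-ν - 1 / 2) * g u) x =
      1 / 2 * ∫ w in Ioi (0 : ℝ), (w : ℂ) ^ (-b) * quadTransform stieltjesKernel h w := by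
  obtain ⟨hae, hI⟩ := H
  have e : ∀ x : ℝ, ∀ u ∈ Ioi (0 : ℝ),
      widderIntegrand (fun u : ℝ => (u : ℂ) ^ (-ν - 1 / 2) * g u) x u =
        h u / ((u ^ 2 + x ^ 2 : ℝ) : ℂ) := by
    intro x u hu
    have hu0 : (u : ℂ) ≠ 0 := by exact_mod_cast (ne_of_gt hu)
    rw [widderIntegrand, hh]
    simp only
    rw [show (1 / 2 - ν : ℂ) = 1 + (-ν - 1 / 2) by ring, Complex.cpow_add _ _ hu0,
      Complex.cpow_one]
    push_cast
    ring
  constructor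
  · obtain ⟨x, hx, hxi⟩ := exists_pos_of_ae_restrict_Ioi hae
    have h1 := hxi.congr_fun (e x) measurableSet_Ioi
    have hmul : (fun u : ℝ => h u / (1 + u ^ 2 : ℝ)) =
        fun u => h u / ((u ^ 2 + x ^ 2 : ℝ) : ℂ) * (((u ^ 2 + x ^ 2) / (1 + u ^ 2) : ℝ) : ℂ) := by
      funext u
      have h2 : ((u ^ 2 + x ^ 2 : ℝ) : ℂ) ≠ 0 := by
        exact_mod_cast (by positivity : 0 < u ^ 2 + x ^ 2).ne'
      rw [Complex.ofReal_div]
      field_simp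
    rw [hmul]
    refine Integrable.mul_bdd (c := 1 + x ^ 2) h1 (Measurable.aestronglyMeasurable ?_) ?_
    · exact Complex.measurable_ofReal.comp (((measurable_id.pow_const 2).add_const _).div
        ((measurable_id.pow_const 2).const_add 1))
    · refine Filter.Eventually.of_forall fun u => ?_
      rw [Complex.norm_real, Real.norm_of_nonneg (by positivity), div_le_iff₀ (by positivity)]
      nlinarith [sq_nonneg u, sq_nonneg x, mul_nonneg (sq_nonneg u) (sq_nonneg x)]
  · refine integral_cpow_mul_of_rpow_substitution (p := -(1 / 2)) (by norm_num) ?_ (by norm_num) hI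
    intro w hw
    have hw0 : (w : ℂ) ≠ 0 := by exact_mod_cast hw.ne'
    have hW : widderTransform (fun u : ℝ => (u : ℂ) ^ (-ν - 1 / 2) * g u)
        (w ^ (-(1 / 2) : ℝ)) = w * quadTransform stieltjesKernel h w := by
      rw [widderTransform, setIntegral_congr_fun measurableSet_Ioi (e _), quadTransform,
        ← integral_const_mul]
      refine integral_congr_ae (Filter.Eventually.of_forall fun u => ?_)
      have h2 : (w ^ (-(1 / 2) : ℝ)) ^ 2 = w⁻¹ := by
        rw [← Real.rpow_natCast, ← Real.rpow_mul hw.le, ← Real.rpow_neg_one]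
        norm_num
      have h3 : ((1 + w * u ^ 2 : ℝ) : ℂ) ≠ 0 := by
        exact_mod_cast (by positivity : 0 < 1 + w * u ^ 2).ne'
      have h4 : ((u ^ 2 + w⁻¹ : ℝ) : ℂ) = ((1 + w * u ^ 2 : ℝ) : ℂ) / w := by
        push_cast
        field_simp
        ring
      simp only [stieltjesKernel]
      rw [h2, h4]
      field_simp
    have h5 : ((|(-(1 / 2) : ℝ)| * w ^ ((-(1 / 2) : ℝ) - 1) : ℝ) : ℂ) =
        1 / 2 * (w : ℂ) ^ (-(3 / 2) : ℂ) := by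
      rw [Complex.ofReal_mul, Complex.ofReal_cpow hw.le]
      norm_num
    have h6 : (w : ℂ) ^ (-b) = (w : ℂ) ^ (-(3 / 2) : ℂ) *
        (w : ℂ) ^ (((-(1 / 2) : ℝ) : ℂ) * (μ + ν + 1 / 2)) * w := by
      nth_rewrite 4 [← Complex.cpow_one (w : ℂ)]
      rw [← Complex.cpow_add _ _ hw0, ← Complex.cpow_add _ _ hw0, hb]
      congr 1
      push_cast
      ring
    rw [hW, h5, h6, ofReal_rpow_cpow hw]
    ring

/-- The substitution `y = w ^ (1/2)` in the moment of the Macdonald transform. -/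
theorem KMomentExists.reduce {μ ν b : ℂ} {g h : ℝ → ℂ}
    (hb : b = μ / 2 + ν / 2 + 3 / 4) (hh : h = fun u : ℝ => (u : ℂ) ^ (1 / 2 - ν) * g u)
    (H : KMomentExists ν (-μ - 1) g) :
    (∃ w₀ : ℝ, 0 < w₀ ∧ IntegrableOn (fun u : ℝ => heatMacdonald ν (w₀ * u ^ 2) * h u) (Ioi 0)) ∧
    IntegrableOn (fun w : ℝ => (w : ℂ) ^ (-b) * quadTransform (heatMacdonald ν) h w) (Ioi 0) ∧
    ∫ y in Ioi (0 : ℝ), (y : ℂ) ^ (-μ - 1) * kTransform ν g y =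
      (2 : ℂ) ^ (ν - 2) *
        ∫ w in Ioi (0 : ℝ), (w : ℂ) ^ (-b) * quadTransform (heatMacdonald ν) h w := by
  obtain ⟨hae, hI⟩ := H
  have e : ∀ y : ℝ, 0 < y → ∀ u ∈ Ioi (0 : ℝ), kIntegrand ν g y u =
      (2 : ℂ) ^ (ν - 1) * (y : ℂ) ^ (1 / 2 - ν) * (heatMacdonald ν (y ^ 2 * u ^ 2) * h u) := by
    intro y hy u hu
    have hu' : (0 : ℝ) < u := hu
    have huy : 0 < u * y := mul_pos hu' hy
    have huy0 : ((u * y : ℝ) : ℂ) ≠ 0 := by exact_mod_cast huy.ne'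
    have h1 := heatMacdonald_sq ν huy
    have h2 : ((Real.sqrt (u * y) : ℝ) : ℂ) = ((u * y : ℝ) : ℂ) ^ (1 / 2 : ℂ) := by
      rw [Real.sqrt_eq_rpow, Complex.ofReal_cpow huy.le]
      norm_num
    have h3 : ((u * y : ℝ) : ℂ) ^ (1 / 2 - ν) = (u : ℂ) ^ (1 / 2 - ν) * (y : ℂ) ^ (1 / 2 - ν) := by
      rw [Complex.ofReal_mul, Complex.mul_cpow_ofReal_nonneg hu'.le hy.le]
    have h4 : ((u * y / 2 : ℝ) : ℂ) ^ ν = ((u * y : ℝ) : ℂ) ^ ν * (2 : ℂ) ^ (-ν) := by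
      rw [div_eq_mul_inv, Complex.ofReal_mul,
        Complex.mul_cpow_ofReal_nonneg huy.le (by norm_num), ofReal_inv_cpow two_pos]
      norm_num
    have h5 : (2 : ℂ) ^ ν ≠ 0 := by simp [Complex.cpow_eq_zero_iff]
    have h6 : ((u * y : ℝ) : ℂ) ^ ν ≠ 0 := by simp [Complex.cpow_eq_zero_iff, hy.ne', hu'.ne']
    rw [show y ^ 2 * u ^ 2 = (u * y) ^ 2 by ring, h1, h4, kIntegrand, h2, hh]
    simp only
    rw [show (2 : ℂ) ^ (ν - 1) * (y : ℂ) ^ (1 / 2 - ν) * (2 * (((u * y : ℝ) : ℂ) ^ ν *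
        (2 : ℂ) ^ (-ν)) * macdonaldK ν (u * y) * ((u : ℂ) ^ (1 / 2 - ν) * g u)) =
        (2 : ℂ) ^ (ν - 1) * 2 * (2 : ℂ) ^ (-ν) * (((u : ℂ) ^ (1 / 2 - ν) *
        (y : ℂ) ^ (1 / 2 - ν)) * ((u * y : ℝ) : ℂ) ^ ν) * macdonaldK ν (u * y) * g u by ring,
      ← h3, Complex.cpow_sub _ _ huy0, Complex.cpow_sub _ _ two_ne_zero, Complex.cpow_one,
      Complex.cpow_neg]
    field_simp
  constructor
  · obtain ⟨y, hy, hyi⟩ := exists_pos_of_ae_restrict_Ioi hae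
    refine ⟨y ^ 2, by positivity, ?_⟩
    have hne : (2 : ℂ) ^ (ν - 1) * (y : ℂ) ^ (1 / 2 - ν) ≠ 0 := by
      simp [Complex.cpow_eq_zero_iff, hy.ne']
    have h1 := (hyi.congr_fun (e y hy) measurableSet_Ioi).const_mul
      ((2 : ℂ) ^ (ν - 1) * (y : ℂ) ^ (1 / 2 - ν))⁻¹
    refine IntegrableOn.congr_fun h1 (fun u _ => ?_) measurableSet_Ioi
    rw [inv_mul_cancel_left₀ hne]
  · refine integral_cpow_mul_of_rpow_substitution (p := 1 / 2) (by norm_num) ?_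
      (by simp [Complex.cpow_eq_zero_iff]) hI
    intro w hw
    have hw0 : (w : ℂ) ≠ 0 := by exact_mod_cast hw.ne'
    have hy : 0 < w ^ (1 / 2 : ℝ) := by positivity
    have h2 : (w ^ (1 / 2 : ℝ)) ^ 2 = w := by
      rw [← Real.rpow_natCast, ← Real.rpow_mul hw.le]
      norm_num
    have hK : kTransform ν g (w ^ (1 / 2 : ℝ)) = (2 : ℂ) ^ (ν - 1) *
        ((w ^ (1 / 2 : ℝ) : ℝ) : ℂ) ^ (1 / 2 - ν) * quadTransform (heatMacdonald ν) h w := by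
      rw [kTransform, setIntegral_congr_fun measurableSet_Ioi (e _ hy), integral_const_mul, h2,
        quadTransform]
    have h5 : ((|(1 / 2 : ℝ)| * w ^ ((1 / 2 : ℝ) - 1) : ℝ) : ℂ) =
        1 / 2 * (w : ℂ) ^ (-(1 / 2) : ℂ) := by
      rw [Complex.ofReal_mul, Complex.ofReal_cpow hw.le, abs_of_pos (by norm_num)]
      norm_num
    have h6 : (w : ℂ) ^ (-b) = (w : ℂ) ^ (-(1 / 2) : ℂ) *
        (w : ℂ) ^ (((1 / 2 : ℝ) : ℂ) * (-μ - 1)) * (w : ℂ) ^ (((1 / 2 : ℝ) : ℂ) * (1 / 2 - ν)) := by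
      rw [← Complex.cpow_add _ _ hw0, ← Complex.cpow_add _ _ hw0, hb]
      congr 1
      push_cast
      ring
    have h7 : (2 : ℂ) ^ (ν - 1) = (2 : ℂ) ^ (ν - 2) * 2 := by
      rw [show ν - 1 = (ν - 2) + 1 by ring, Complex.cpow_add _ _ two_ne_zero, Complex.cpow_one]
    rw [hK, h5, h6, h7, ofReal_rpow_cpow hw, ofReal_rpow_cpow hw]
    ring

/-- For `Re b ≥ 1` the `(2 * b - 2)`-th moment controls `h` away from `0`. -/
theorem integrableOn_of_norm_le_near_zero {b : ℂ} (hb : 1 ≤ b.re) {h k : ℝ → ℂ}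
    (hm : AEStronglyMeasurable h (volume.restrict (Ioi 0))) (hk : IntegrableOn k (Ioi 0))
    (hM : IntegrableOn (fun u : ℝ => (u : ℂ) ^ (2 * b - 2) * h u) (Ioi 0)) {δ C : ℝ} (hδ : 0 < δ)
    (hC : 0 ≤ C) (hle : ∀ u, 0 < u → u ≤ δ → ‖h u‖ ≤ C * ‖k u‖) : IntegrableOn h (Ioi 0) := by
  refine ((hk.norm.const_mul C).add
    (hM.norm.const_mul (δ ^ (2 * b - 2).re)⁻¹)).mono' hm ?_
  filter_upwards [ae_restrict_mem measurableSet_Ioi] with u hu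
  have hu' : (0 : ℝ) < u := hu
  have hd : 0 < δ ^ (2 * b - 2).re := Real.rpow_pos_of_pos hδ _
  have p1 : 0 ≤ C * ‖k u‖ := by positivity
  have p2 : 0 ≤ (δ ^ (2 * b - 2).re)⁻¹ * ‖(u : ℂ) ^ (2 * b - 2) * h u‖ := by positivity
  rcases le_total u δ with hu1 | hu1
  · exact (hle u hu' hu1).trans (le_add_of_nonneg_right p2)
  · refine le_trans ?_ (le_add_of_nonneg_left p1)
    have h1 : δ ^ (2 * b - 2).re ≤ u ^ (2 * b - 2).re :=
      Real.rpow_le_rpow hδ.le hu1 (by simp; linarith)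
    beta_reduce
    rw [norm_mul, Complex.norm_cpow_eq_rpow_re_of_pos hu', inv_mul_eq_div, le_div_iff₀ hd,
      mul_comm]
    gcongr

/-! ### The three identities -/

theorem mainTheorem5 (μ ν : ℂ) (g : ℝ → ℂ)
    (hμ₁ : -ν.re - 3 / 2 < μ.re) (hμ₂ : μ.re < -1 / 2) :
    (WidderMomentExists (μ + ν + 1 / 2) (fun u : ℝ => (u : ℂ) ^ (-ν - 1 / 2) * g u) →
      KMomentExists ν (-μ - 1) g →
      ∫ x in Ioi (0 : ℝ), (x : ℂ) ^ (μ + ν + 1 / 2) *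
          widderTransform (fun u : ℝ => (u : ℂ) ^ (-ν - 1 / 2) * g u) x =
        (2 : ℂ) ^ (μ + 1 / 2) *
          (Complex.Gamma (μ / 2 + ν / 2 + 3 / 4) / Complex.Gamma (ν / 2 - μ / 2 + 1 / 4)) *
          ∫ y in Ioi (0 : ℝ), (y : ℂ) ^ (-μ - 1) * kTransform ν g y) ∧
    ((∀ n : ℕ, 1 / 4 - μ / 2 - ν / 2 ≠ -(n : ℂ)) →
      KMomentExists ν (-μ - 1) g →
      IntegrableOn (fun u : ℝ => (u : ℂ) ^ μ * g u) (Ioi 0) →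
      ∫ y in Ioi (0 : ℝ), (y : ℂ) ^ (-μ - 1) * kTransform ν g y =
        (2 : ℂ) ^ (-μ - 3 / 2) * Complex.Gamma (ν / 2 - μ / 2 + 1 / 4) *
          Complex.Gamma (1 / 4 - μ / 2 - ν / 2) *
          ∫ u in Ioi (0 : ℝ), (u : ℂ) ^ μ * g u) ∧
    ((∀ n : ℕ, 1 / 4 - μ / 2 - ν / 2 ≠ -(n : ℂ)) →
      WidderMomentExists (μ + ν + 1 / 2) (fun u : ℝ => (u : ℂ) ^ (-ν - 1 / 2) * g u) →
      IntegrableOn (fun u : ℝ => (u : ℂ) ^ μ * g u) (Ioi 0) →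
      ∫ x in Ioi (0 : ℝ), (x : ℂ) ^ (μ + ν + 1 / 2) *
          widderTransform (fun u : ℝ => (u : ℂ) ^ (-ν - 1 / 2) * g u) x =
        1 / 2 * Complex.Gamma (μ / 2 + ν / 2 + 3 / 4) *
          Complex.Gamma (1 / 4 - μ / 2 - ν / 2) *
          ∫ u in Ioi (0 : ℝ), (u : ℂ) ^ μ * g u) := by
  set b : ℂ := μ / 2 + ν / 2 + 3 / 4 with hb
  set h : ℝ → ℂ := fun u : ℝ => (u : ℂ) ^ (1 / 2 - ν) * g u with hh
  have hν : -1 < ν.re := by linarith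
  have hbre : b.re = μ.re / 2 + ν.re / 2 + 3 / 4 := by
    rw [hb]; simp
  have hb0 : 0 < b.re := by rw [hbre]; linarith
  have hνb : ν / 2 - μ / 2 + 1 / 4 = ν + 1 - b := by rw [hb]; ring
  have hνb0 : 0 < (ν + 1 - b).re := by
    have : (ν + 1 - b).re = ν.re + 1 - b.re := by simp
    rw [this, hbre]
    linarith
  have h1b : 1 / 4 - μ / 2 - ν / 2 = 1 - b := by rw [hb]; ring
  rw [hνb, h1b]
  have eμ : ∀ u ∈ Ioi (0 : ℝ), (u : ℂ) ^ μ * g u = (u : ℂ) ^ (2 * b - 2) * h u := by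
    intro u hu
    have hu0 : (u : ℂ) ≠ 0 := by exact_mod_cast (ne_of_gt hu)
    rw [hh]
    simp only
    rw [← mul_assoc, ← Complex.cpow_add _ _ hu0, hb]
    congr 2
    ring
  have hmeasW (hW : IntegrableOn (fun u : ℝ => h u / (1 + u ^ 2 : ℝ)) (Ioi 0)) :
      AEStronglyMeasurable h (volume.restrict (Ioi 0)) := by
    have h1 : h = fun u => h u / (1 + u ^ 2 : ℝ) * ((1 + u ^ 2 : ℝ) : ℂ) := by
      funext u
      rw [div_mul_cancel₀]
      exact_mod_cast (by positivity : (0 : ℝ) < 1 + u ^ 2).ne'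
    rw [h1]
    exact hW.aestronglyMeasurable.mul (Continuous.aestronglyMeasurable (by fun_prop))
  have hmeasM (hM : IntegrableOn (fun u : ℝ => (u : ℂ) ^ (2 * b - 2) * h u) (Ioi 0)) :
      AEStronglyMeasurable h (volume.restrict (Ioi 0)) := by
    refine AEStronglyMeasurable.congr ((measurable_ofReal_cpow (2 - 2 * b)).aestronglyMeasurable.mul
      hM.aestronglyMeasurable) ?_
    filter_upwards [ae_restrict_mem measurableSet_Ioi] with u hu
    have hu0 : (u : ℂ) ≠ 0 := by exact_mod_cast (ne_of_gt hu)
    rw [Pi.mul_apply, ← mul_assoc, ← Complex.cpow_add _ _ hu0]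
    simp
  refine ⟨fun HW HK => ?_, fun hn HK HM => ?_, fun hn HW HM => ?_⟩
  · obtain ⟨hW, hI1, eW⟩ := HW.reduce hb hh
    obtain ⟨⟨w₀, hw₀, hK⟩, hI2, eK⟩ := HK.reduce hb hh
    have := Gamma_mul_integral_quadTransform_heatMacdonald hν hb0 hνb0 (hmeasW hW) hW hw₀ hK
      hI1 hI2
    have hG : Complex.Gamma (ν + 1 - b) ≠ 0 := Complex.Gamma_ne_zero_of_re_pos hνb0
    have h2 : (2 : ℂ) ^ (μ + 1 / 2) * (2 : ℂ) ^ (ν - 2) * (2 : ℂ) ^ (2 - 2 * b) = 1 / 2 := by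
      rw [← Complex.cpow_add _ _ two_ne_zero, ← Complex.cpow_add _ _ two_ne_zero,
        show μ + 1 / 2 + (ν - 2) + (2 - 2 * b) = -1 by rw [hb]; ring, Complex.cpow_neg_one]
      norm_num
    have h3 : Complex.Gamma b / Complex.Gamma (ν + 1 - b) *
        ∫ w in Ioi (0 : ℝ), (w : ℂ) ^ (-b) * quadTransform (heatMacdonald ν) h w =
        (2 : ℂ) ^ (2 - 2 * b) *
          ∫ w in Ioi (0 : ℝ), (w : ℂ) ^ (-b) * quadTransform stieltjesKernel h w := by
      rw [div_mul_eq_mul_div, this, div_eq_iff hG]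
      ring
    rw [eW, eK]
    linear_combination
      (-∫ w in Ioi (0 : ℝ), (w : ℂ) ^ (-b) * quadTransform stieltjesKernel h w) * h2 -
      (2 : ℂ) ^ (μ + 1 / 2) * (2 : ℂ) ^ (ν - 2) * h3
  · have hM := HM.congr_fun eμ measurableSet_Ioi
    obtain ⟨⟨w₀, hw₀, hK⟩, hI2, eK⟩ := HK.reduce hb hh
    obtain ⟨n1, n2⟩ := integral_cpow_mul_exp_mul_inv_four_mul hνb0
    have hm := hmeasM hM
    have hnm : AEStronglyMeasurable (fun τ : ℝ => (τ : ℂ) ^ (ν - 1) * (Real.exp (-τ) : ℂ))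
        (volume.restrict (Ioi 0)) :=
      ((measurable_ofReal_cpow _).mul (Complex.measurable_ofReal.comp
        (Real.measurable_exp.comp measurable_id.neg))).aestronglyMeasurable
    have hint : b.re < 1 ∨
        IntegrableOn (fun τ : ℝ => (τ : ℂ) ^ (ν - 1) * (Real.exp (-τ) : ℂ)) (Ioi 0) ∧
        IntegrableOn h (Ioi 0) := by
      refine (lt_or_ge b.re 1).imp_right fun hb1 => ?_
      -- here `Re ν > 0`, so the kernel is bounded below near `0` and controls `h` there
      have hν0 : 0 < ν.re := by rw [hbre] at hb1; linarith
      refine ⟨by simpa using integrableOn_cpow_mul_exp_neg_mul hν0 one_pos, ?_⟩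
      obtain ⟨δ, hδ, c, hc, hδc⟩ := exists_le_norm_heatMacdonald hν0
      set u₀ : ℝ := Real.sqrt (δ / (2 * w₀)) with hu₀
      have hu₀0 : 0 < u₀ := Real.sqrt_pos.mpr (by positivity)
      have hu₀2 : w₀ * u₀ ^ 2 = δ / 2 := by
        rw [hu₀, Real.sq_sqrt (by positivity)]
        field_simp
      refine integrableOn_of_norm_le_near_zero hb1 hm hK hM hu₀0 (C := c⁻¹) (by positivity)
        fun u hu hle => ?_
      have h3 : w₀ * u ^ 2 ≤ w₀ * u₀ ^ 2 := by gcongr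
      have h4 := hδc (w₀ * u ^ 2) (by positivity) (by linarith)
      rw [norm_mul (heatMacdonald ν (w₀ * u ^ 2)), inv_mul_eq_div, le_div_iff₀ hc, mul_comm]
      exact mul_le_mul_of_nonneg_right h4 (norm_nonneg _)
    have := integral_cpow_neg_mul_quadTransform (k := heatMacdonald ν) hnm hm
      (measurable_id.const_mul 4).inv (fun τ hτ => by simp [hτ])
      (fun z _ => heatMacdonald_eq_expSuperposition ν z) hb0 hn n1 hM hint hI2
    have n2' : ∫ τ in Ioi (0 : ℝ), (τ : ℂ) ^ (ν - 1) * (Real.exp (-τ) : ℂ) *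
        (((fun τ : ℝ => 4 * τ)⁻¹ τ : ℝ) : ℂ) ^ (b - 1) =
        (2 : ℂ) ^ (2 - 2 * b) * Complex.Gamma (ν + 1 - b) := n2
    simp only [id] at this
    rw [n2'] at this
    have h2 : (2 : ℂ) ^ (ν - 2) * (2 : ℂ) ^ (2 - 2 * b) = (2 : ℂ) ^ (-μ - 3 / 2) := by
      rw [← Complex.cpow_add _ _ two_ne_zero]
      congr 1
      rw [hb]
      ring
    rw [eK, this, setIntegral_congr_fun measurableSet_Ioi eμ, ← h2]
    ring
  · have hM := HM.congr_fun eμ measurableSet_Ioi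
    obtain ⟨hW, hI1, eW⟩ := HW.reduce hb hh
    have hm := hmeasW hW
    have eΓ : ∀ τ : ℝ, (τ : ℂ) ^ (b - 1) * (Real.exp (-(1 * τ)) : ℂ) =
        (Real.exp (-τ) : ℂ) * (τ : ℂ) ^ (b - 1) := fun τ => by rw [one_mul, mul_comm]
    have n1 := integrableOn_cpow_mul_exp_neg_mul hb0 one_pos
    have n2 := integral_cpow_mul_exp_neg_mul hb0 one_pos
    simp only [eΓ] at n1 n2
    have hint : b.re < 1 ∨ IntegrableOn (fun τ : ℝ => (Real.exp (-τ) : ℂ)) (Ioi 0) ∧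
        IntegrableOn h (Ioi 0) := by
      refine (lt_or_ge b.re 1).imp_right fun hb1 => ?_
      refine ⟨by simpa using integrableOn_pow_mul_exp_neg_mul 0 one_pos, ?_⟩
      refine integrableOn_of_norm_le_near_zero hb1 hm hW hM one_pos (C := 2) two_pos.le
        fun u hu hle => ?_
      have h3 : u ^ 2 ≤ 1 := pow_le_one₀ hu.le hle
      rw [norm_div, Complex.norm_real, Real.norm_of_nonneg (by positivity), ← mul_div_assoc,
        le_div_iff₀ (by positivity)]
      nlinarith [norm_nonneg (h u)]
    have hk : ∀ z, 0 < z → stieltjesKernel z =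
        ∫ τ in Ioi (0 : ℝ), (Real.exp (-τ) : ℂ) * (Real.exp (-(z * τ)) : ℂ) := by
      intro z hz
      have h3 := integral_pow_mul_exp_neg_mul 0 (r := 1 + z) (by linarith)
      rw [stieltjesKernel]
      simp only [pow_zero, one_mul, Nat.factorial_zero, Nat.cast_one, zero_add, pow_one,
        one_div] at h3
      rw [← h3]
      refine integral_congr_ae (Filter.Eventually.of_forall fun τ => ?_)
      simp only
      rw [← Complex.ofReal_mul, ← Real.exp_add]
      ring_nf
    have := integral_cpow_neg_mul_quadTransform (k := stieltjesKernel)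
      (r := fun τ => τ) (Continuous.aestronglyMeasurable (by fun_prop)) hm
      measurable_id (fun τ hτ => hτ) hk hb0 hn n1 hM hint hI1
    rw [n2] at this
    rw [eW, this, setIntegral_congr_fun measurableSet_Ioi eμ]
    simp
    ring
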